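/- **Setting.** $N\ge 1$ agents $\mathcal V=\{1,\dots,N\}$ with local functions $f_i:\mathbb R^l\to\mathbb R^l$ search for a root of $f=\frac1N\sum_{i=1}^N f_i$; let $J=\{x: f(x)=0\}$, assumed non-empty. At time $k$ the agents communicate over a digraph $\mathcal G(k)=(\mathcal V,\mathcal E(k))$ containing all self-loops, with weights $W(k)=[\omega_{ij}(k)]$, where $\omega_{ij}(k)>0$ if $(j,i)\in\mathcal E(k)$ and $\omega_{ij}(k)=0$ otherwise; $N_i(k)=\{j:(j,i)\in\mathcal E(k)\}$. Let $x^*\in\mathbb R^l$, let $(M_k)_{k\ge0}$ be positive numbers increasing to infinity with $M_0\ge\|x^*\|$, let $\gamma_k$ be the step sizes and $\varepsilon_{i,k+1}$ the observation noises, and put $O_{i,k+1}=f_i(x_{i,k})+\varepsilon_{i,k+1}$. From arbitrary initial values $x_{i,0}$ and $\sigma_{i,0}=0$, the algorithm DSAAWET computes $\hat\sigma_{i,k}=\max_{j\in N_i(k)}\sigma_{j,k}$, $$x'_{i,k+1}=\begin{cases}\displaystyle\sum_{j\in N_i(k)}\omega_{ij}(k)\bigl(x_{j,k}I_{[\sigma_{j,k}=\hat\sigma_{i,k}]}+x^*I_{[\sigma_{j,k}<\hat\sigma_{i,k}]}\bigr)+\gamma_kO_{i,k+1},&\sigma_{i,k}=\hat\sigma_{i,k},\\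 x^*,&\sigma_{i,k}<\hat\sigma_{i,k},\end{cases}$$ and sets $x_{i,k+1}=x'_{i,k+1}$, $\sigma_{i,k+1}=\hat\sigma_{i,k}$ if $\|x'_{i,k+1}\|\le M_{\hat\sigma_{i,k}}$, and $x_{i,k+1}=x^*$, $\sigma_{i,k+1}=\hat\sigma_{i,k}+1$ (a truncation) otherwise. **Assumptions.** A1. $\gamma_k>0$, $\gamma_k\to0$, $\sum_{k\ge1}\gamma_k=\infty$. A2. There is a continuously differentiable $v:\mathbb R^l\to\mathbb R$ such that (a) $\sup_{\delta\le d(x,J)\le\Delta}f(x)^T\nabla v(x)<0$ for all $\Delta>\delta>0$ (with $\sup\emptyset=-\infty$); (b) $v(J)$ is nowhere dense; (c) $\|x^*\|<c_0$ and $v(x^*)<\inf_{\|x\|=c_0}v(x)$ for some $c_0>0$. A3. All $f_i$ are continuous. A4. (a) Every $W(k)$ is doubly stochastic; (b) for some $0<\eta<1$, $\omega_{ij}(k)\ge\eta$ for all $i$, $k$ and $j\in N_i(k)$; (c) the digraph $(\mathcal V,\mathcal E_\infty)$ is strongly connected, where $\mathcal E_\infty$ is the set of pairs $(j,i)$ that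 lie in $\mathcal E(k)$ for infinitely many $k$; (d) for some positive integer $B$, every $(j,i)\in\mathcal E_\infty$ lies in $\mathcal E(k)\cup\dots\cup\mathcal E(k+B-1)$ for every $k\ge0$. A5 (for agent $i$, on a sample path). (a) $\gamma_k\varepsilon_{i,k+1}\to0$; (b) for every strictly increasing sequence of indices $(n_k)$ along which $x_{i,n_k}$ converges, for all sufficiently large $K$, $$\lim_{T\to0}\limsup_{k\to\infty}\frac1T\Bigl\|\sum_{m=n_k}^{m(n_k,t_k)}\gamma_m\varepsilon_{i,m+1}I_{[\|x_{i,m}\|\le K]}\Bigr\|=0\qquad\text{for all choices of } t_k\in[0,T],$$ where $m(k,T)=\max\{m:\sum_{i=k}^m\gamma_i\le T\}$. **Theorem.** Assume A1–A4. Then on every sample path on which A5 holds for all agents: (i) every sequence $\{x_{i,k}\}_k$ is bounded, and there is a positive integer $k_0$, possibly depending on the sample path, after which no truncation occurs ($\sigma_{i,k+1}=\sigma_{i,k}$ for all $i$ and $k\ge k_0$) and $$x_{i,k+1}=\sum_{j\in N_i(k)}\omega_{ij}(k)x_{j,k}+\gamma_kO_{i,k+1}\qquad\text{for all } i \text{ and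 } k\ge k_0,$$ that is, $X_{k+1}=(W(k)\otimes I_l)X_k+\gamma_k(F(X_k)+\varepsilon_{k+1})$ with the stacked vectors $X_k=\mathrm{col}\{x_{1,k},\dots,x_{N,k}\}$, $F(X_k)=\mathrm{col}\{f_1(x_{1,k}),\dots,f_N(x_{N,k})\}$, $\varepsilon_k=\mathrm{col}\{\varepsilon_{1,k},\dots,\varepsilon_{N,k}\}$; (ii) the disagreement vector $\bigl((I_N-\tfrac1N\mathbf 1\mathbf 1^T)\otimes I_l\bigr)X_k$ tends to $0$, and $d(x_k,J)\to0$ for the average $x_k=\frac1N\sum_{i=1}^Nx_{i,k}$; (iii) there is a (non-empty) connected set $J^*\subset J$ such that $d(x_k,J^*)\to0$. -/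

import Mathlib

open Filter Topology
open scoped Kronecker

noncomputable section

/-- The Euclidean space `ℝ^l`. -/
abbrev Vec (l : ℕ) : Type := EuclideanSpace ℝ (Fin l)

/-- The data of the distributed stochastic approximation algorithm with expanding truncations for
`N` agents in `ℝ^l`, together with the standing conventions on these data: local functions `f i`,
step sizes `γ k`, communication digraphs `G k`, adjacency matrices `W k`, the common reset point
`xstar` and the truncation bounds `M k`. -/
structure DSAAWET (N l : ℕ) where
  f : Fin N → Vec l → Vec l
  γ : ℕ → ℝ
  /-- `(G k).Adj j i` means that agent `i` gets information from agent `j` at time `k`. -/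
  G : ℕ → Digraph (Fin N)
  W : ℕ → Matrix (Fin N) (Fin N) ℝ
  xstar : Vec l
  M : ℕ → ℝ
  adj_self : ∀ k i, (G k).Adj i i
  weight_pos_iff : ∀ k i j, 0 < W k i j ↔ (G k).Adj j i
  weight_eq_zero : ∀ k i j, ¬ (G k).Adj j i → W k i j = 0
  M_pos : ∀ k, 0 < M k
  M_mono : Monotone M
  M_tendsto : Tendsto M atTop atTop
  norm_xstar_le : ‖xstar‖ ≤ M 0

namespace DSAAWET

variable {N l : ℕ} (S : DSAAWET N l)

/-! ### The sum function and its roots -/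

/-- `f = (1/N) ∑ f_i`. -/
def meanFun (x : Vec l) : Vec l := (1 / (N : ℝ)) • ∑ i, S.f i x

/-- The root set `J` of the sum function. -/
def rootSet : Set (Vec l) := {x | S.meanFun x = 0}

/-! ### The algorithm -/

open Classical in
/-- The neighbours `N_i(k)` of agent `i` at time `k`. -/
def nbr (k : ℕ) (i : Fin N) : Finset (Fin N) := {j | (S.G k).Adj j i}

/-- `σ̂_{i,k} = max_{j ∈ N_i(k)} σ_{j,k}`. -/
def sigmaHat (k : ℕ) (σ : Fin N → ℕ) (i : Fin N) : ℕ := (S.nbr k i).sup σ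

/-- The local noisy observation `O_{i,k+1} = f_i(x_{i,k}) + ε_{i,k+1}`. -/
def observation (x e : Fin N → Vec l) (i : Fin N) : Vec l := S.f i (x i) + e i

/-- The intermediate value `x'_{i,k+1}`, computed from the estimates `x`, the truncation numbers
`σ` at time `k` and the noise `e` at time `k + 1`. -/
def intermediate (k : ℕ) (x : Fin N → Vec l) (σ : Fin N → ℕ) (e : Fin N → Vec l) (i : Fin N) :
    Vec l :=
  if σ i = S.sigmaHat k σ i then
    (∑ j ∈ S.nbr k i, S.W k i j • (if σ j = S.sigmaHat k σ i then x j else S.xstar))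
      + S.γ k • S.observation x e i
  else S.xstar

/-- The pairs (estimates, truncation numbers) of all agents at time `k`, for the initial values
`x₀` and the noise sequences `ε` (where `ε i (k + 1)` is the noise of agent `i` in its observation
at time `k + 1`; the value `ε i 0` is not used). -/
def state (x₀ : Fin N → Vec l) (ε : Fin N → ℕ → Vec l) : ℕ → (Fin N → Vec l) × (Fin N → ℕ)
  | 0 => (x₀, fun _ => 0)
  | k + 1 =>
    let x := (state x₀ ε k).1
    let σ := (state x₀ ε k).2
    let x' := S.intermediate k x σ (fun i => ε i (k + 1))
    (fun i => if ‖x' i‖ ≤ S.M (S.sigmaHat k σ i) then x' i else S.xstar,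
     fun i => S.sigmaHat k σ i + if S.M (S.sigmaHat k σ i) < ‖x' i‖ then 1 else 0)

/-- The estimate `x_{i,k}`. -/
def est (x₀ : Fin N → Vec l) (ε : Fin N → ℕ → Vec l) (i : Fin N) (k : ℕ) : Vec l :=
  (S.state x₀ ε k).1 i

/-- The truncation number `σ_{i,k}`. -/
def truncNum (x₀ : Fin N → Vec l) (ε : Fin N → ℕ → Vec l) (i : Fin N) (k : ℕ) : ℕ :=
  (S.state x₀ ε k).2 i

/-! ### Assumptions -/

/-- Positive step sizes that tend to zero and have a divergent sum. -/
def StepSizeCondition : Prop :=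
  (∀ k, 0 < S.γ k) ∧ Tendsto S.γ atTop (𝓝 0) ∧
    Tendsto (fun n => ∑ k ∈ Finset.Icc 1 n, S.γ k) atTop atTop

/-- Existence of a Lyapunov function `v`. The first item says that the supremum of
`f(x)ᵀ v_x(x)` over `δ ≤ d(x, J) ≤ Δ` is negative (with `sup ∅ = -∞`). -/
def LyapunovCondition : Prop :=
  ∃ v : Vec l → ℝ, ContDiff ℝ 1 v ∧
    (∀ δ Δ : ℝ, 0 < δ → δ < Δ → ∃ α : ℝ, 0 < α ∧
      ∀ x, δ ≤ Metric.infDist x S.rootSet → Metric.infDist x S.rootSet ≤ Δ →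
        inner ℝ (S.meanFun x) (gradient v x) ≤ -α) ∧
    IsNowhereDense (v '' S.rootSet) ∧
    ∃ c₀ : ℝ, 0 < c₀ ∧ ‖S.xstar‖ < c₀ ∧ v S.xstar < sInf (v '' {x | ‖x‖ = c₀})

/-- The edges `(j, i)` that occur at infinitely many times. -/
def edgeInfty (j i : Fin N) : Prop := {k | (S.G k).Adj j i}.Infinite

/-- Doubly stochastic weights, bounded below on edges; the digraph of the edges that occur
infinitely often is strongly connected, and each of its edges occurs in every time window of
length `B`. -/
def NetworkCondition : Prop :=
  (∀ k, S.W k ∈ doublyStochastic ℝ (Fin N)) ∧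
  (∃ η : ℝ, 0 < η ∧ η < 1 ∧ ∀ k i, ∀ j ∈ S.nbr k i, η ≤ S.W k i j) ∧
  (∀ i j, Relation.ReflTransGen S.edgeInfty i j) ∧
  ∃ B : ℕ, 0 < B ∧ ∀ j i, S.edgeInfty j i → ∀ k, ∃ s < B, (S.G (k + s)).Adj j i

/-- `m(k, T) = max {m : ∑_{i=k}^m γ_i ≤ T}`. -/
def mTime (k : ℕ) (T : ℝ) : ℕ := sSup {m : ℕ | ∑ i ∈ Finset.Icc k m, S.γ i ≤ T}

/-- The noise condition for one agent with noise sequence `e` and estimate sequence `x`. The second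
item says: whenever `x (n k)` converges along indices `n k`, then for all sufficiently large `K`,
`lim_{T → 0} limsup_{k → ∞} (1/T) ‖∑_{m = n_k}^{m(n_k, t_k)} γ_m e_{m+1} I[‖x_m‖ ≤ K]‖ = 0`
for all choices of `t_k ∈ [0, T]`. -/
def NoiseCondition (e x : ℕ → Vec l) : Prop :=
  Tendsto (fun k => S.γ k • e (k + 1)) atTop (𝓝 0) ∧
  ∀ n : ℕ → ℕ, StrictMono n → (∃ y, Tendsto (fun k => x (n k)) atTop (𝓝 y)) →
    ∃ K₀ : ℝ, ∀ K ≥ K₀, ∀ δ > 0, ∀ᶠ T : ℝ in 𝓝[>] 0, ∀ᶠ k in atTop, ∀ t ∈ Set.Icc 0 T,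
      1 / T * ‖∑ m ∈ Finset.Icc (n k) (S.mTime (n k) t),
        if ‖x m‖ ≤ K then S.γ m • e (m + 1) else 0‖ ≤ δ

end DSAAWET

/-! ### Stacked vectors -/

/-- `col {x_1, …, x_N}`, with coordinates indexed by (agent, coordinate). -/
def stack {N l : ℕ} (x : Fin N → Vec l) : Fin N × Fin l → ℝ := fun p => x p.1 p.2

/-- `D_⊥ = (I_N - 𝟏𝟏ᵀ/N) ⊗ I_l`. -/
def disagreementMatrix (N l : ℕ) : Matrix (Fin N × Fin l) (Fin N × Fin l) ℝ :=
  ((1 : Matrix (Fin N) (Fin N) ℝ) - (1 / (N : ℝ)) • Matrix.of fun _ _ => (1 : ℝ)) ⊗ₖ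
    (1 : Matrix (Fin l) (Fin l) ℝ)

end

/-!
While the largest truncation number in the network (the *level*) stays constant, the agents at that
level run plain consensus averaging with increments `γ_k (f_i + ε_i)`, and the others have no
influence: replacing the estimates of the lagging agents by the reset point gives the auxiliary
estimates `auxEst`, which restart together from the reset point whenever the level rises. The level
spreads through the network within a bounded number `L` of steps, so lagging agents occur only just
after such a restart, when all auxiliary estimates are still near the reset point. Hence the
auxiliary estimates obey the averaging scheme up to perturbations that vanish as long as the
estimates stay in a fixed ball. The transition matrices over `L` steps have entries bounded below,
which contracts the diameter of the family of estimates (`norm_sub_le_of_perturbed_averaging`), so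
the disagreement vanishes as well.

Double stochasticity turns the average over the agents into a centralized stochastic approximation
with the mean field `f`. Along a bounded regular stretch starting near a point `z`, it moves during
a short time `T` (on the scale of the step sizes) by approximately `T f(z)`
(`eventually_norm_avg_sub_sub_le`); if `z` is not a root, the Lyapunov function `v` drops by a
multiple of `T` (`exists_eventually_apply_avg_le`). Consequently `v` cannot make infinitely many
upcrossings from a value `a` that it does not attain at a root (`false_of_upcrossings`): the
starting points would accumulate at a point with `v = a`, where `v` decreases.

If the truncations never ended, then after every late restart the
average would have to leave the ball of radius `c₀`, and `v` would cross upwards between two values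
separating `v(x*)` from its infimum over the sphere (`exists_upcrossing_of_unbounded`); so the level
is bounded (`exists_level_le`) and the truncations stop. After that, the values of `v` along the
averages converge, because the values not attained at roots are dense (`exists_tendsto_apply_avg`),
and then every cluster point of the averages is a root, since near any other point `v` would drop
by a fixed amount infinitely often (`mem_rootSet_of_mapClusterPt`). Finally, the steps of the
averages vanish, so their set of cluster points is connected (`isConnected_setOf_mapClusterPt`).
-/

/-! ### Averaging with stochastic matrices -/

section Consensus

variable {n : Type*} [Fintype n] {E : Type*} [NormedAddCommGroup E] [NormedSpace ℝ E]

/-- Two weighted averages of a finite family of diameter at most `d` are closer than `d` by a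
definite factor if both put weight at least `c` on a common member: the pairs `(j₀, j₀)` do not
contribute to the double sum `∑ a_j b_k (X_j - X_k)`. -/
theorem norm_sum_smul_sub_sum_smul_le {a b : n → ℝ} (ha : ∀ j, 0 ≤ a j) (hb : ∀ j, 0 ≤ b j)
    (ha1 : ∑ j, a j = 1) (hb1 : ∑ j, b j = 1) {c : ℝ} (hc : 0 ≤ c) {j₀ : n} (hca : c ≤ a j₀)
    (hcb : c ≤ b j₀) {X : n → E} {d : ℝ} (hX : ∀ j k, ‖X j - X k‖ ≤ d) :
    ‖∑ j, a j • X j - ∑ j, b j • X j‖ ≤ (1 - c ^ 2) * d := by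
  classical
  have hd : 0 ≤ d := (norm_nonneg _).trans (hX j₀ j₀)
  have key : ∑ j, a j • X j - ∑ j, b j • X j = ∑ p : n × n, (a p.1 * b p.2) • (X p.1 - X p.2) := by
    rw [Fintype.sum_prod_type]
    have h1 : ∀ j, ∑ k, (a j * b k) • (X j - X k)
        = a j • X j - a j • ∑ k, b k • X k := by
      intro j
      simp only [smul_sub, Finset.sum_sub_distrib]
      rw [← Finset.sum_smul, ← Finset.mul_sum, hb1, mul_one, Finset.smul_sum]
      simp only [mul_smul]
    simp only [h1, Finset.sum_sub_distrib, ← Finset.sum_smul, ha1, one_smul]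
  have hterm : ∀ p : n × n, ‖(a p.1 * b p.2) • (X p.1 - X p.2)‖
      ≤ a p.1 * b p.2 * d - if p = (j₀, j₀) then c ^ 2 * d else 0 := by
    intro p
    rw [norm_smul, Real.norm_of_nonneg (mul_nonneg (ha _) (hb _))]
    split_ifs with h
    · subst h
      have : c ^ 2 ≤ a j₀ * b j₀ := by
        rw [sq]; exact mul_le_mul hca hcb hc (ha _)
      simpa using mul_le_mul_of_nonneg_right this hd
    · rw [sub_zero]
      exact mul_le_mul_of_nonneg_left (hX _ _) (mul_nonneg (ha _) (hb _))
  rw [key]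
  refine (norm_sum_le _ _).trans ((Finset.sum_le_sum fun p _ => hterm p).trans ?_)
  rw [Finset.sum_sub_distrib, ← Finset.sum_mul, Fintype.sum_prod_type]
  simp [← Finset.mul_sum, ha1, hb1, sub_mul]

theorem norm_sum_smul_le {a : n → ℝ} (ha : ∀ j, 0 ≤ a j) (ha1 : ∑ j, a j = 1) {X : n → E} {R : ℝ}
    (hX : ∀ j, ‖X j‖ ≤ R) : ‖∑ j, a j • X j‖ ≤ R := by
  calc ‖∑ j, a j • X j‖ ≤ ∑ j, a j * R := by
        refine norm_sum_le_of_le _ fun j _ => ?_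
        rw [norm_smul, Real.norm_of_nonneg (ha j)]
        exact mul_le_mul_of_nonneg_left (hX j) (ha j)
    _ = R := by rw [← Finset.sum_mul, ha1, one_mul]

theorem norm_sum_smul_sub_le {a : n → ℝ} (ha : ∀ j, 0 ≤ a j) (ha1 : ∑ j, a j = 1) {X : n → E}
    {z : E} {R : ℝ} (hX : ∀ j, ‖X j - z‖ ≤ R) : ‖∑ j, a j • X j - z‖ ≤ R := by
  have : ∑ j, a j • X j - z = ∑ j, a j • (X j - z) := by
    simp [smul_sub, ← Finset.sum_smul, ha1]
  rw [this]
  exact norm_sum_smul_le ha ha1 hX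

variable [DecidableEq n]

/-- The transition matrix `W (q + t - 1) ⋯ W (q + 1) W q` of the time-varying averaging from time
`q` to time `q + t`. -/
def transition (W : ℕ → Matrix n n ℝ) (q : ℕ) : ℕ → Matrix n n ℝ
  | 0 => 1
  | t + 1 => W (q + t) * transition W q t

variable {W : ℕ → Matrix n n ℝ}

theorem transition_mem_rowStochastic (hW : ∀ k, W k ∈ Matrix.rowStochastic ℝ n) (q t : ℕ) :
    transition W q t ∈ Matrix.rowStochastic ℝ n := by
  induction t with
  | zero => exact one_mem _
  | succ t ih => exact mul_mem (hW _) ih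

/-- Perturbations of size `β` in each averaging step accumulate at most linearly. -/
theorem norm_sub_transition_le (hW : ∀ k, W k ∈ Matrix.rowStochastic ℝ n) {X : ℕ → n → E} {β : ℝ}
    (τ t : ℕ)
    (hX : ∀ q, τ ≤ q → q < τ + t → ∀ i, ‖X (q + 1) i - ∑ j, W q i j • X q j‖ ≤ β) (i : n) :
    ‖X (τ + t) i - ∑ j, transition W τ t i j • X τ j‖ ≤ t * β := by
  induction t generalizing i with
  | zero => simp [transition, Matrix.one_apply]
  | succ t ih =>
    have ih' := ih fun q h1 h2 => hX q h1 (by omega)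
    have hsum : ∑ j, transition W τ (t + 1) i j • X τ j
        = ∑ k, W (τ + t) i k • ∑ j, transition W τ t k j • X τ j := by
      simp only [transition, Matrix.mul_apply, Finset.sum_smul, Finset.smul_sum, mul_smul]
      exact Finset.sum_comm
    have hsplit : X (τ + (t + 1)) i - ∑ j, transition W τ (t + 1) i j • X τ j
        = (X (τ + t + 1) i - ∑ j, W (τ + t) i j • X (τ + t) j)
          + ∑ k, W (τ + t) i k • (X (τ + t) k - ∑ j, transition W τ t k j • X τ j) := by
      rw [hsum]; simp only [smul_sub, Finset.sum_sub_distrib]; rw [← add_assoc]; abel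
    rw [hsplit]
    have hW' := (Matrix.mem_rowStochastic_iff_sum.1 (hW (τ + t)))
    calc _ ≤ β + t * β := (norm_add_le _ _).trans (add_le_add (hX _ (by omega) (by omega) i)
            (norm_sum_smul_le (hW'.1 i) (hW'.2 i) ih'))
      _ = _ := by push_cast; ring

/-- If all transition matrices over `L` steps have entries at least `c`, the diameter of a family
that evolves by averaging with perturbations of size `β` decays geometrically up to a multiple of
`β`. -/
theorem norm_sub_le_of_perturbed_averaging (hW : ∀ k, W k ∈ Matrix.rowStochastic ℝ n) {L : ℕ}
    (hL : 0 < L) {c : ℝ} (hc : 0 < c) (hΦ : ∀ q i j, c ≤ transition W q L i j)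
    {X : ℕ → n → E} {β D : ℝ} (hβ : 0 ≤ β) {τ : ℕ} (hD : ∀ i j, ‖X τ i - X τ j‖ ≤ D) (t : ℕ)
    (hX : ∀ q, τ ≤ q → q < τ + t → ∀ i, ‖X (q + 1) i - ∑ j, W q i j • X q j‖ ≤ β) (i j : n) :
    ‖X (τ + t) i - X (τ + t) j‖ ≤ (1 - c ^ 2) ^ (t / L) * D + 2 * L * β / c ^ 2 := by
  have hdiff : ∀ (c' : ℝ) (q s : ℕ) (d : ℝ), 0 ≤ c' → (∀ i j, c' ≤ transition W q s i j) →
      τ ≤ q → q + s ≤ τ + t → (∀ i j, ‖X q i - X q j‖ ≤ d) →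
      ∀ i j, ‖X (q + s) i - X (q + s) j‖ ≤ (1 - c' ^ 2) * d + 2 * s * β := by
    intro c' q s d hc' hΦ' hq hs hd i j
    have h1 := norm_sub_transition_le hW q s (X := X) (β := β)
      fun p hp1 hp2 => hX p (by omega) (by omega)
    have hrow := Matrix.mem_rowStochastic_iff_sum.1 (transition_mem_rowStochastic hW q s)
    have h2 := norm_sum_smul_sub_sum_smul_le (hrow.1 i) (hrow.1 j) (hrow.2 i) (hrow.2 j) hc'
      (hΦ' i i) (hΦ' j i) hd
    have h3 : X (q + s) i - X (q + s) j
        = (X (q + s) i - ∑ k, transition W q s i k • X q k)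
          - (X (q + s) j - ∑ k, transition W q s j k • X q k)
          + (∑ k, transition W q s i k • X q k - ∑ k, transition W q s j k • X q k) := by abel
    rw [h3]
    refine (norm_add_le _ _).trans ?_
    have h4 := norm_sub_le (X (q + s) i - ∑ k, transition W q s i k • X q k)
      (X (q + s) j - ∑ k, transition W q s j k • X q k)
    linarith [h1 i, h1 j]
  have hc1 : c ≤ 1 := by
    have hrow := transition_mem_rowStochastic hW 0 L
    exact (hΦ 0 i i).trans (Matrix.le_one_of_mem_rowStochastic hrow)
  have hc2 : c ^ 2 ≤ 1 := by nlinarith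
  induction t using Nat.strong_induction_on generalizing i j with
  | _ t ih =>
    rcases lt_or_ge t L with h | h
    · rw [Nat.div_eq_of_lt h, pow_zero, one_mul]
      have h1 := hdiff 0 τ t D le_rfl
        (fun i j => (transition_mem_rowStochastic hW τ t).1 i j) le_rfl le_rfl hD i j
      have h2 : (t : ℝ) ≤ L := by exact_mod_cast h.le
      have h3 : 2 * t * β ≤ 2 * L * β / c ^ 2 := by
        rw [le_div_iff₀ (by positivity)]
        have : 2 * t * β * c ^ 2 ≤ 2 * t * β * 1 := by gcongr
        have : 2 * t * β ≤ 2 * L * β := by gcongr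
        linarith
      linarith
    · obtain ⟨s, rfl⟩ := Nat.exists_eq_add_of_le' h
      have h1 := fun i' j' => ih s (by omega) (fun q h1 h2 => hX q h1 (by omega)) i' j'
        (fun c' q r d a1 a2 a3 a4 => hdiff c' q r d a1 a2 a3 (by omega))
      have h2 := hdiff c (τ + s) L _ hc.le (hΦ _) (by omega) (by omega) h1 i j
      rw [← add_assoc, Nat.add_div_right _ hL]
      refine h2.trans (le_of_eq ?_)
      rw [pow_succ]
      field_simp
      ring

end Consensus

/-! ### The communication network -/

namespace DSAAWET

variable {N l : ℕ} (S : DSAAWET N l)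

theorem mem_nbr {k : ℕ} {i j : Fin N} : j ∈ S.nbr k i ↔ (S.G k).Adj j i := by
  simp [nbr]

theorem sum_nbr_smul (k : ℕ) (i : Fin N) (g : Fin N → Vec l) :
    ∑ j ∈ S.nbr k i, S.W k i j • g j = ∑ j, S.W k i j • g j := by
  refine Finset.sum_subset (Finset.subset_univ _) fun j _ hj => ?_
  rw [S.weight_eq_zero k i j fun h => hj (S.mem_nbr.2 h), zero_smul]

variable {S}

theorem NetworkCondition.mem_rowStochastic (h : S.NetworkCondition) (k : ℕ) :
    S.W k ∈ Matrix.rowStochastic ℝ (Fin N) :=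
  (mem_doublyStochastic_iff_mem_rowStochastic_and_mem_colStochastic.1 (h.1 k)).1

/-- Along a path of recurrent edges information arrives within a bounded time, and self-loops
preserve it afterwards; hence some transition matrices over a fixed number of steps have entries
bounded away from zero. -/
theorem NetworkCondition.exists_le_transition (h : S.NetworkCondition) :
    ∃ L : ℕ, 0 < L ∧ ∃ c : ℝ, 0 < c ∧ ∀ q i j, c ≤ transition S.W q L i j := by
  have hrow := h.mem_rowStochastic
  obtain ⟨-, ⟨η, hη, -, hW⟩, hconn, B, -, hB⟩ := h
  have hmul : ∀ q t i k j (a : ℝ), 0 ≤ a → (S.G (q + t)).Adj k i → a ≤ transition S.W q t k j →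
      η * a ≤ transition S.W q (t + 1) i j := by
    intro q t i k j a ha hk hkj
    have h0 := (transition_mem_rowStochastic hrow q t).1
    calc η * a ≤ S.W (q + t) i k * transition S.W q t k j :=
          mul_le_mul (hW _ _ _ (S.mem_nbr.2 hk)) hkj ha ((hrow _).1 _ _)
      _ ≤ ∑ k', S.W (q + t) i k' * transition S.W q t k' j :=
          Finset.single_le_sum (f := fun k' => S.W (q + t) i k' * transition S.W q t k' j)
            (fun k' _ => mul_nonneg ((hrow _).1 _ _) (h0 _ _)) (Finset.mem_univ k)
      _ = _ := by rw [transition, Matrix.mul_apply]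
  have hstay : ∀ q t s i j, η ^ t ≤ transition S.W q t i j →
      η ^ (t + s) ≤ transition S.W q (t + s) i j := by
    intro q t s i j ht
    induction s with
    | zero => simpa using ht
    | succ s ih =>
      rw [← add_assoc, pow_succ']
      exact hmul q (t + s) i i j _ (by positivity) (S.adj_self _ _) ih
  have hpath : ∀ j i, ∃ T : ℕ, ∀ q, ∀ t ≥ T, η ^ t ≤ transition S.W q t i j := by
    intro j i
    induction hconn j i with
    | refl =>
      refine ⟨0, fun q t _ => ?_⟩
      simpa using hstay q 0 t j j (by simp [transition])
    | @tail b d _ hbd ih =>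
      obtain ⟨T, hT⟩ := ih
      refine ⟨T + B, fun q t ht => ?_⟩
      obtain ⟨s, hs, hadj⟩ := hB _ _ hbd (q + T)
      have h1 := hmul q (T + s) d b j _ (by positivity) (by rwa [← add_assoc])
        (hT q (T + s) (by omega))
      rw [← pow_succ'] at h1
      have h2 := hstay q (T + s + 1) (t - (T + s + 1)) d j h1
      rwa [Nat.add_sub_cancel' (by omega)] at h2
  choose T hT using hpath
  refine ⟨(Finset.univ.sup fun p : Fin N × Fin N => T p.1 p.2) + 1, by omega,
    η ^ ((Finset.univ.sup fun p : Fin N × Fin N => T p.1 p.2) + 1), by positivity,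
    fun q i j => hT j i q _ ?_⟩
  have := Finset.le_sup (f := fun p : Fin N × Fin N => T p.1 p.2) (Finset.mem_univ (j, i))
  simp only at this
  omega

/-! ### Truncation numbers and the auxiliary estimates -/

variable (S) (x₀ : Fin N → Vec l) (ε : Fin N → ℕ → Vec l)

/-- The value `σ̂_{i,k}` along the run of the algorithm. -/
noncomputable def hatNum (i : Fin N) (k : ℕ) : ℕ := S.sigmaHat k (fun j => S.truncNum x₀ ε j k) i

/-- The intermediate value `x'_{i,k+1}` along the run of the algorithm. -/
noncomputable def candidate (i : Fin N) (k : ℕ) : Vec l :=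
  S.intermediate k (fun j => S.est x₀ ε j k) (fun j => S.truncNum x₀ ε j k) (fun j => ε j (k + 1)) i

/-- The largest truncation number in the network at time `k`. -/
noncomputable def level (k : ℕ) : ℕ := Finset.univ.sup fun i => S.truncNum x₀ ε i k

/-- The auxiliary estimates: those of the agents whose truncation number is the largest one, and
the reset point for the agents that lag behind. -/
noncomputable def auxEst (i : Fin N) (k : ℕ) : Vec l :=
  if S.truncNum x₀ ε i k = S.level x₀ ε k then S.est x₀ ε i k else S.xstar

theorem est_succ (i : Fin N) (k : ℕ) : S.est x₀ ε i (k + 1) =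
    if ‖S.candidate x₀ ε i k‖ ≤ S.M (S.hatNum x₀ ε i k) then S.candidate x₀ ε i k else S.xstar :=
  rfl

theorem truncNum_succ (i : Fin N) (k : ℕ) : S.truncNum x₀ ε i (k + 1) =
    S.hatNum x₀ ε i k + if S.M (S.hatNum x₀ ε i k) < ‖S.candidate x₀ ε i k‖ then 1 else 0 :=
  rfl

theorem candidate_eq (i : Fin N) (k : ℕ) : S.candidate x₀ ε i k =
    if S.truncNum x₀ ε i k = S.hatNum x₀ ε i k then
      (∑ j, S.W k i j •
        (if S.truncNum x₀ ε j k = S.hatNum x₀ ε i k then S.est x₀ ε j k else S.xstar))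
        + S.γ k • (S.f i (S.est x₀ ε i k) + ε i (k + 1))
    else S.xstar := by
  rw [← S.sum_nbr_smul]
  rfl

theorem truncNum_le_level (i : Fin N) (k : ℕ) : S.truncNum x₀ ε i k ≤ S.level x₀ ε k :=
  Finset.le_sup (f := fun i => S.truncNum x₀ ε i k) (Finset.mem_univ i)

theorem truncNum_le_hatNum {i j : Fin N} {k : ℕ} (h : (S.G k).Adj j i) :
    S.truncNum x₀ ε j k ≤ S.hatNum x₀ ε i k :=
  Finset.le_sup (f := fun j => S.truncNum x₀ ε j k) (S.mem_nbr.2 h)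

theorem hatNum_le_level (i : Fin N) (k : ℕ) : S.hatNum x₀ ε i k ≤ S.level x₀ ε k := by
  rw [hatNum, sigmaHat]
  exact Finset.sup_le fun j _ => S.truncNum_le_level x₀ ε j k

theorem hatNum_le_truncNum_succ (i : Fin N) (k : ℕ) :
    S.hatNum x₀ ε i k ≤ S.truncNum x₀ ε i (k + 1) := by
  rw [truncNum_succ]; omega

theorem truncNum_succ_le (i : Fin N) (k : ℕ) :
    S.truncNum x₀ ε i (k + 1) ≤ S.hatNum x₀ ε i k + 1 := by
  rw [truncNum_succ]; split_ifs <;> omega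

theorem level_mono : Monotone (S.level x₀ ε) := by
  refine monotone_nat_of_le_succ fun k => Finset.sup_le fun i _ => ?_
  exact (S.truncNum_le_hatNum x₀ ε (S.adj_self k i)).trans
    ((S.hatNum_le_truncNum_succ x₀ ε i k).trans (S.truncNum_le_level x₀ ε i _))

theorem level_succ_le (k : ℕ) : S.level x₀ ε (k + 1) ≤ S.level x₀ ε k + 1 :=
  Finset.sup_le fun i _ => (S.truncNum_succ_le x₀ ε i k).trans
    (Nat.add_le_add_right (S.hatNum_le_level x₀ ε i k) 1)

theorem level_le (k : ℕ) : S.level x₀ ε k ≤ k := by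
  induction k with
  | zero => exact Finset.sup_le fun i _ => le_rfl
  | succ k ih => exact (S.level_succ_le x₀ ε k).trans (by omega)

/-- Truncation numbers spread along the communication digraphs. -/
theorem truncNum_le_of_transition_pos (hW : ∀ k, S.W k ∈ Matrix.rowStochastic ℝ (Fin N))
    {q t : ℕ} {i j : Fin N} (h : 0 < transition S.W q t i j) :
    S.truncNum x₀ ε j q ≤ S.truncNum x₀ ε i (q + t) := by
  induction t generalizing i with
  | zero =>
    rw [transition, Matrix.one_apply] at h
    split_ifs at h with hij
    · rw [hij, add_zero]
    · exact absurd h (lt_irrefl _)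
  | succ t ih =>
    rw [transition, Matrix.mul_apply] at h
    obtain ⟨k, -, hk⟩ := Finset.exists_lt_of_sum_lt (f := fun _ => (0 : ℝ)) (by simpa using h)
    have h1 := (hW (q + t)).1 i k
    have h2 := (transition_mem_rowStochastic hW q t).1 k j
    have h3 : 0 < S.W (q + t) i k := h1.lt_of_ne fun h0 => by simp [← h0] at hk
    have h4 : 0 < transition S.W q t k j := h2.lt_of_ne fun h0 => by simp [← h0] at hk
    exact (ih h4).trans ((S.truncNum_le_hatNum x₀ ε ((S.weight_pos_iff _ _ _).1 h3)).trans
      (S.hatNum_le_truncNum_succ x₀ ε i _))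

theorem level_le_truncNum_add (hW : ∀ k, S.W k ∈ Matrix.rowStochastic ℝ (Fin N)) {L : ℕ}
    (hL : ∀ q i j, 0 < transition S.W q L i j) (i : Fin N) (q : ℕ) :
    S.level x₀ ε q ≤ S.truncNum x₀ ε i (q + L) :=
  Finset.sup_le fun j _ => S.truncNum_le_of_transition_pos x₀ ε hW (hL q i j)

theorem norm_xstar_le_M (k : ℕ) : ‖S.xstar‖ ≤ S.M k :=
  S.norm_xstar_le.trans (S.M_mono (Nat.zero_le k))

theorem norm_est_succ_le (i : Fin N) (k : ℕ) :
    ‖S.est x₀ ε i (k + 1)‖ ≤ S.M (S.level x₀ ε k) := by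
  rw [est_succ]
  split_ifs with h
  · exact h.trans (S.M_mono (S.hatNum_le_level x₀ ε i k))
  · exact S.norm_xstar_le_M _

theorem auxEst_of_truncNum_ne {i : Fin N} {k : ℕ} (h : S.truncNum x₀ ε i k ≠ S.level x₀ ε k) :
    S.auxEst x₀ ε i k = S.xstar := if_neg h

theorem auxEst_of_truncNum_eq {i : Fin N} {k : ℕ} (h : S.truncNum x₀ ε i k = S.level x₀ ε k) :
    S.auxEst x₀ ε i k = S.est x₀ ε i k := if_pos h

theorem hatNum_eq_level {i : Fin N} {k : ℕ} (h : S.truncNum x₀ ε i k = S.level x₀ ε k) :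
    S.hatNum x₀ ε i k = S.level x₀ ε k :=
  le_antisymm (S.hatNum_le_level x₀ ε i k)
    (h.symm.le.trans (S.truncNum_le_hatNum x₀ ε (S.adj_self k i)))

theorem candidate_of_truncNum_eq {i : Fin N} {k : ℕ}
    (h : S.truncNum x₀ ε i k = S.level x₀ ε k) : S.candidate x₀ ε i k =
      (∑ j, S.W k i j • S.auxEst x₀ ε j k) + S.γ k • (S.f i (S.auxEst x₀ ε i k) + ε i (k + 1)) := by
  have h' := S.hatNum_eq_level x₀ ε h
  rw [candidate_eq, if_pos (h.trans h'.symm), S.auxEst_of_truncNum_eq x₀ ε h, h']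
  rfl

/-- While the level stays constant, the agents at that level follow the plain averaging scheme. -/
theorem auxEst_succ_of_truncNum_eq {i : Fin N} {k : ℕ}
    (h : S.truncNum x₀ ε i k = S.level x₀ ε k) (hl : S.level x₀ ε (k + 1) = S.level x₀ ε k) :
    S.truncNum x₀ ε i (k + 1) = S.level x₀ ε (k + 1) ∧ S.auxEst x₀ ε i (k + 1) =
      (∑ j, S.W k i j • S.auxEst x₀ ε j k) + S.γ k • (S.f i (S.auxEst x₀ ε i k) + ε i (k + 1)) := by
  have h' := S.hatNum_eq_level x₀ ε h
  have h1 : S.truncNum x₀ ε i (k + 1) = S.level x₀ ε (k + 1) :=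
    le_antisymm (S.truncNum_le_level x₀ ε i _)
      (by rw [hl, ← h']; exact S.hatNum_le_truncNum_succ x₀ ε i k)
  refine ⟨h1, ?_⟩
  have h2 : ‖S.candidate x₀ ε i k‖ ≤ S.M (S.hatNum x₀ ε i k) := by
    by_contra hlt
    have := S.truncNum_succ x₀ ε i k
    rw [if_pos (not_le.1 hlt), h1, hl, h'] at this
    omega
  rw [S.auxEst_of_truncNum_eq x₀ ε h1, est_succ, if_pos h2, S.candidate_of_truncNum_eq x₀ ε h]

/-- While the level stays constant, agents below it have auxiliary estimates at the reset point
also one step later: either they still lag behind, or they have just reached the level, and then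
they have been reset. -/
theorem auxEst_succ_of_truncNum_ne {i : Fin N} {k : ℕ}
    (h : S.truncNum x₀ ε i k ≠ S.level x₀ ε k) (hl : S.level x₀ ε (k + 1) = S.level x₀ ε k) :
    S.auxEst x₀ ε i (k + 1) = S.xstar := by
  by_cases h1 : S.truncNum x₀ ε i (k + 1) = S.level x₀ ε (k + 1)
  · rw [S.auxEst_of_truncNum_eq x₀ ε h1, est_succ]
    split_ifs with hc
    · have h2 := S.truncNum_succ x₀ ε i k
      rw [if_neg (not_lt.2 hc), h1, hl, add_zero] at h2
      rw [candidate_eq, if_neg (by rwa [← h2])]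
    · rfl
  · exact S.auxEst_of_truncNum_ne x₀ ε h1

/-- When the level rises, all auxiliary estimates are reset. -/
theorem auxEst_succ_of_level_lt (i : Fin N) {k : ℕ} (hl : S.level x₀ ε k < S.level x₀ ε (k + 1)) :
    S.auxEst x₀ ε i (k + 1) = S.xstar := by
  by_cases h1 : S.truncNum x₀ ε i (k + 1) = S.level x₀ ε (k + 1)
  · rw [S.auxEst_of_truncNum_eq x₀ ε h1, est_succ, if_neg]
    intro hc
    have h2 := S.truncNum_succ x₀ ε i k
    rw [if_neg (not_lt.2 hc), h1, add_zero] at h2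
    exact absurd (S.hatNum_le_level x₀ ε i k) (by omega)
  · exact S.auxEst_of_truncNum_ne x₀ ε h1

/-- When the level rises, some agent at the old level had a candidate outside the bound. -/
theorem exists_candidate_of_level_lt {k : ℕ} (hl : S.level x₀ ε k < S.level x₀ ε (k + 1)) :
    ∃ i, S.truncNum x₀ ε i k = S.level x₀ ε k ∧
      S.M (S.level x₀ ε k) < ‖S.candidate x₀ ε i k‖ := by
  obtain ⟨i, -, hi⟩ := Finset.lt_sup_iff.1 hl
  have h0 := S.hatNum_le_level x₀ ε i k
  have h1 : S.hatNum x₀ ε i k = S.level x₀ ε k ∧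
      S.M (S.hatNum x₀ ε i k) < ‖S.candidate x₀ ε i k‖ := by
    rw [truncNum_succ] at hi
    split_ifs at hi with h
    · exact ⟨by omega, h⟩
    · omega
  refine ⟨i, ?_, h1.1 ▸ h1.2⟩
  by_contra hne
  rw [candidate_eq, if_neg (by rwa [h1.1])] at h1
  exact absurd h1.2 (not_lt.2 (S.norm_xstar_le_M _))

end DSAAWET

/-! ### Sums of step sizes -/

namespace DSAAWET

variable {N l : ℕ} {S : DSAAWET N l}

theorem StepSizeCondition.exists_le_sum_Icc (h : S.StepSizeCondition) (n : ℕ) (A : ℝ) :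
    ∃ p, n ≤ p ∧ A ≤ ∑ m ∈ Finset.Icc n p, S.γ m := by
  obtain ⟨p, hp, hp'⟩ := ((h.2.2.eventually_ge_atTop
    (∑ k ∈ Finset.Icc 1 n, S.γ k + A)).and (eventually_ge_atTop n)).exists
  refine ⟨p, hp', ?_⟩
  have h1 : ∑ k ∈ Finset.Icc 1 p, S.γ k
      ≤ ∑ k ∈ Finset.Icc 1 n, S.γ k + ∑ k ∈ Finset.Icc n p, S.γ k := by
    rw [← Finset.sum_union_inter]
    refine le_add_of_le_of_nonneg (Finset.sum_le_sum_of_subset_of_nonneg ?_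
      fun k _ _ => (h.1 k).le) (Finset.sum_nonneg fun k _ => (h.1 k).le)
    intro k hk
    simp only [Finset.mem_union, Finset.mem_Icc] at hk ⊢
    omega
  linarith

/-- A time interval starting at `n` of length between `T / 2` and `T` on the time scale of the
step sizes. -/
theorem StepSizeCondition.exists_sum_Icc_mem (h : S.StepSizeCondition) {n : ℕ} {T : ℝ}
    (hn : ∀ k ≥ n, S.γ k ≤ T / 2) :
    ∃ p ≥ n, T / 2 ≤ ∑ m ∈ Finset.Icc n p, S.γ m ∧ ∑ m ∈ Finset.Icc n p, S.γ m ≤ T := by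
  classical
  have hex := h.exists_le_sum_Icc n (T / 2)
  refine ⟨Nat.find hex, (Nat.find_spec hex).1, (Nat.find_spec hex).2, ?_⟩
  have hle := (Nat.find_spec hex).1
  have hmin := fun m => Nat.find_min hex (m := m)
  generalize Nat.find hex = p at hle hmin
  rcases hle.eq_or_lt with rfl | hlt
  · have := h.1 n
    simp only [Finset.Icc_self, Finset.sum_singleton]
    linarith [hn n le_rfl]
  · obtain ⟨r, rfl⟩ : ∃ r, p = r + 1 := ⟨p - 1, by omega⟩
    have h1 := hmin r (by omega)
    rw [Finset.sum_Icc_succ_top (by omega)]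
    have h2 : ∑ m ∈ Finset.Icc n r, S.γ m < T / 2 := by
      by_contra hc
      exact h1 ⟨by omega, not_lt.1 hc⟩
    linarith [hn (r + 1) (by omega)]

theorem StepSizeCondition.mTime_sum (h : S.StepSizeCondition) {n p : ℕ} (hnp : n ≤ p) :
    S.mTime n (∑ m ∈ Finset.Icc n p, S.γ m) = p := by
  refine IsGreatest.csSup_eq ⟨le_refl (∑ m ∈ Finset.Icc n p, S.γ m), fun m hm => ?_⟩
  by_contra hlt
  refine absurd hm (not_le.2 (Finset.sum_lt_sum_of_subset (i := m) ?_ ?_ ?_ (h.1 m)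
    fun k _ _ => (h.1 k).le))
  · exact Finset.Icc_subset_Icc_right (not_le.1 hlt).le
  · exact Finset.mem_Icc.2 ⟨by omega, le_rfl⟩
  · simp only [Finset.mem_Icc]; omega

theorem norm_sum_step_smul_le (hγ : ∀ k, 0 < S.γ k) {n p : ℕ} {w : ℕ → Vec l} {B : ℝ}
    (hw : ∀ m ∈ Finset.Icc n p, ‖w m‖ ≤ B) :
    ‖∑ m ∈ Finset.Icc n p, S.γ m • w m‖ ≤ (∑ m ∈ Finset.Icc n p, S.γ m) * B := by
  rw [Finset.sum_mul]
  refine norm_sum_le_of_le _ fun m hm => ?_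
  rw [norm_smul, Real.norm_of_nonneg (hγ m).le]
  exact mul_le_mul_of_nonneg_left (hw m hm) (hγ m).le

/-! ### Stretches of regular behaviour and the drift of the average -/

/-- The average of a family of vectors over the agents. -/
noncomputable def avg (y : Fin N → Vec l) : Vec l := (1 / (N : ℝ)) • ∑ i, y i

theorem avg_sub (y z : Fin N → Vec l) : avg (fun i => y i - z i) = avg y - avg z := by
  simp [avg, Finset.sum_sub_distrib, smul_sub]

theorem avg_add (y z : Fin N → Vec l) : avg (fun i => y i + z i) = avg y + avg z := by
  simp [avg, Finset.sum_add_distrib, smul_add]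

theorem avg_const (hN : 0 < N) (z : Vec l) : avg (fun _ : Fin N => z) = z := by
  have : (N : ℝ) ≠ 0 := by positivity
  simp [avg, ← Nat.cast_smul_eq_nsmul ℝ, smul_smul, this]

theorem norm_avg_le (hN : 0 < N) {y : Fin N → Vec l} {B : ℝ} (hy : ∀ i, ‖y i‖ ≤ B) :
    ‖avg y‖ ≤ B := by
  have hN' : (0 : ℝ) < N := by exact_mod_cast hN
  rw [avg, Finset.smul_sum]
  refine norm_sum_smul_le (a := fun _ : Fin N => 1 / (N : ℝ)) (fun _ => by positivity) ?_ hy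
  simp [hN'.ne']

theorem norm_avg_sub_le (hN : 0 < N) {y : Fin N → Vec l} {z : Vec l} {B : ℝ}
    (hy : ∀ i, ‖y i - z‖ ≤ B) : ‖avg y - z‖ ≤ B := by
  have := norm_avg_le hN hy
  rwa [avg_sub, avg_const hN] at this

/-- Doubly stochastic averaging leaves the average over the agents unchanged. -/
theorem avg_sum_smul {A : Matrix (Fin N) (Fin N) ℝ} (hA : A ∈ doublyStochastic ℝ (Fin N))
    (y : Fin N → Vec l) : avg (fun i => ∑ j, A i j • y j) = avg y := by
  rw [avg, avg, Finset.sum_comm]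
  simp only [← Finset.sum_smul, sum_col_of_mem_doublyStochastic hA, one_smul]

variable (S) in
/-- On the time interval from `n` to `ℓ` the estimates stay in the ball of radius `R` and within
distance `ρ` of their average, and follow the averaging scheme without truncations. -/
structure RegularOn (x ε : Fin N → ℕ → Vec l) (R ρ : ℝ) (n ℓ : ℕ) : Prop where
  norm_le : ∀ q, n ≤ q → q ≤ ℓ → ∀ i, ‖x i q‖ ≤ R
  near : ∀ q, n ≤ q → q ≤ ℓ → ∀ i, ‖x i q - avg (fun j => x j q)‖ ≤ ρ
  succ_eq : ∀ q, n ≤ q → q < ℓ → ∀ i,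
    x i (q + 1) = ∑ j, S.W q i j • x j q + S.γ q • (S.f i (x i q) + ε i (q + 1))

variable {x ε : Fin N → ℕ → Vec l} {R : ℝ}

theorem RegularOn.mono {ρ ρ' : ℝ} {n n' ℓ ℓ' : ℕ} (h : S.RegularOn x ε R ρ n ℓ) (hn : n ≤ n')
    (hℓ : ℓ' ≤ ℓ) (hρ : ρ ≤ ρ') : S.RegularOn x ε R ρ' n' ℓ' where
  norm_le q h1 h2 := h.norm_le q (by omega) (by omega)
  near q h1 h2 i := (h.near q (by omega) (by omega) i).trans hρ
  succ_eq q h1 h2 := h.succ_eq q (by omega) (by omega)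

theorem RegularOn.avg_sub_eq (hnet : S.NetworkCondition) {ρ : ℝ} {n ℓ p : ℕ}
    (h : S.RegularOn x ε R ρ n ℓ) (hnp : n ≤ p) (hp : p < ℓ) :
    avg (fun i => x i (p + 1)) - avg (fun i => x i n) =
      ∑ m ∈ Finset.Icc n p, S.γ m • avg (fun i => S.f i (x i m))
        + avg (fun i => ∑ m ∈ Finset.Icc n p, S.γ m • ε i (m + 1)) := by
  have h1 : avg (fun i => ∑ m ∈ Finset.Icc n p, S.γ m • ε i (m + 1))
      = ∑ m ∈ Finset.Icc n p, S.γ m • avg (fun i => ε i (m + 1)) := by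
    simp only [avg, Finset.smul_sum]
    rw [Finset.sum_comm]
    exact Finset.sum_congr rfl fun m _ => Finset.sum_congr rfl fun i _ => smul_comm _ _ _
  rw [h1, ← Finset.sum_add_distrib]
  have h2 : ∀ m ∈ Finset.Icc n p, S.γ m • avg (fun i => S.f i (x i m))
      + S.γ m • avg (fun i => ε i (m + 1))
      = avg (fun i => x i (m + 1)) - avg (fun i => x i m) := by
    intro m hm
    rw [Finset.mem_Icc] at hm
    have h3 : (fun i => x i (m + 1)) = fun i => ∑ j, S.W m i j • x j m
        + S.γ m • (S.f i (x i m) + ε i (m + 1)) :=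
      funext fun i => h.succ_eq m hm.1 (by omega) i
    have h4 : ∀ y : Fin N → Vec l, avg (fun i => S.γ m • y i) = S.γ m • avg y := by
      intro y
      simp only [avg, ← Finset.smul_sum]
      rw [smul_comm]
    rw [h3, avg_add, avg_sum_smul (hnet.1 m) (fun j => x j m), h4, avg_add, smul_add]
    abel
  rw [Finset.sum_congr rfl h2, ← Finset.Ico_succ_right_eq_Icc, Nat.succ_eq_succ,
    Finset.sum_Ico_sub (fun m => avg (fun i => x i m)) (by simp; omega)]

theorem exists_norm_f_le (hcont : ∀ i, Continuous (S.f i)) (R : ℝ) :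
    ∃ C : ℝ, 0 ≤ C ∧ ∀ i w, ‖w‖ ≤ R → ‖S.f i w‖ ≤ C := by
  have h : ∀ i, ∃ C : ℝ, ∀ w, ‖w‖ ≤ R → ‖S.f i w‖ ≤ C := fun i => by
    obtain ⟨C, hC⟩ := (isCompact_closedBall (0 : Vec l) R).exists_bound_of_continuousOn
      (hcont i).continuousOn
    exact ⟨C, fun w hw => hC w (by simpa using hw)⟩
  choose C hC using h
  refine ⟨∑ i, |C i|, by positivity, fun i w hw => (hC i w hw).trans ((le_abs_self _).trans ?_)⟩
  exact Finset.single_le_sum (f := fun i => |C i|) (fun _ _ => abs_nonneg _) (Finset.mem_univ i)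

section Drift

variable (hN : 0 < N) (hstep : S.StepSizeCondition) (hcont : ∀ i, Continuous (S.f i))
  (hnet : S.NetworkCondition) (hnoise : ∀ i, S.NoiseCondition (ε i) (x i))
  {n ℓ : ℕ → ℕ} {ρ : ℕ → ℝ} (hn : StrictMono n) (hnℓ : ∀ k, n k < ℓ k)
  (hreg : ∀ k, S.RegularOn x ε R (ρ k) (n k) (ℓ k)) (hρ : Tendsto ρ atTop (𝓝 0))
  {z : Vec l} (hz : Tendsto (fun k => avg (fun i => x i (n k))) atTop (𝓝 z))

include hN hstep hcont hnet hnoise hn hnℓ hreg hρ hz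

/-- From times at which the average is near `z`, regular stretches move it, over a short time on
the scale of the step sizes, approximately along the mean field at `z`. A priori boundedness makes
the indicators in the noise condition disappear, and a crude bound on the displacement keeps the
arguments of the local functions near `z`. -/
theorem eventually_norm_avg_sub_sub_le {δ : ℝ} (hδ : 0 < δ) :
    ∀ᶠ T in 𝓝[>] (0 : ℝ), ∀ᶠ k in atTop, ∀ p, n k ≤ p → p < ℓ k →
      ∑ m ∈ Finset.Icc (n k) p, S.γ m ≤ T →
      ‖avg (fun i => x i (p + 1)) - avg (fun i => x i (n k))
        - (∑ m ∈ Finset.Icc (n k) p, S.γ m) • S.meanFun z‖ ≤ δ * T := by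
  have hxz : ∀ i, Tendsto (fun k => x i (n k)) atTop (𝓝 z) := fun i => by
    have h1 : Tendsto (fun k => x i (n k) - avg (fun j => x j (n k))) atTop (𝓝 0) :=
      squeeze_zero_norm (fun k => (hreg k).near _ le_rfl (hnℓ k).le i) hρ
    simpa using h1.add hz
  obtain ⟨C, hC0, hC⟩ := exists_norm_f_le hcont R
  have hr : ∃ r > 0, ∀ w, ‖w - z‖ < r → ∀ i, ‖S.f i w - S.f i z‖ < δ / 2 := by
    have h1 : ∀ᶠ w in 𝓝 z, ∀ i, ‖S.f i w - S.f i z‖ < δ / 2 := by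
      rw [eventually_all]
      intro i
      have := Metric.tendsto_nhds.1 ((hcont i).tendsto z) (δ / 2) (by positivity)
      simpa [dist_eq_norm] using this
    obtain ⟨r, hr, h2⟩ := Metric.eventually_nhds_iff.1 h1
    exact ⟨r, hr, fun w hw => h2 (by rwa [dist_eq_norm])⟩
  obtain ⟨r, hr, hfr⟩ := hr
  have hnoise' : ∀ᶠ T in 𝓝[>] (0 : ℝ), ∀ i, ∀ᶠ k in atTop, ∀ p, n k ≤ p → p < ℓ k →
      ∑ m ∈ Finset.Icc (n k) p, S.γ m ≤ T →
      ‖∑ m ∈ Finset.Icc (n k) p, S.γ m • ε i (m + 1)‖ ≤ δ / 2 * T := by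
    rw [eventually_all]
    intro i
    obtain ⟨K₀, hK⟩ := (hnoise i).2 n hn ⟨z, hxz i⟩
    filter_upwards [hK (max K₀ R) (le_max_left _ _) (δ / 2) (by positivity),
      self_mem_nhdsWithin] with T hT hT0
    filter_upwards [hT] with k hk p hp1 hp2 hp3
    have h1 := hk _ ⟨Finset.sum_nonneg fun m _ => (hstep.1 m).le, hp3⟩
    rw [hstep.mTime_sum hp1] at h1
    have h2 : ∀ m ∈ Finset.Icc (n k) p,
        (if ‖x i m‖ ≤ max K₀ R then S.γ m • ε i (m + 1) else 0) = S.γ m • ε i (m + 1) := by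
      intro m hm
      rw [Finset.mem_Icc] at hm
      exact if_pos (((hreg k).norm_le m hm.1 (by omega) i).trans (le_max_right _ _))
    rwa [Finset.sum_congr rfl h2, one_div_mul_eq_div, div_le_iff₀ hT0] at h1
  have hTr : ∀ᶠ T in 𝓝[>] (0 : ℝ), (C + δ) * T < r / 2 := by
    have : Tendsto (fun T : ℝ => (C + δ) * T) (𝓝[>] 0) (𝓝 ((C + δ) * 0)) :=
      (continuous_const.mul continuous_id).continuousAt.tendsto.mono_left nhdsWithin_le_nhds
    exact this.eventually_lt_const (by simpa using hr)
  filter_upwards [hnoise', hTr, self_mem_nhdsWithin] with T hT hTr hT0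
  replace hT0 : 0 < T := hT0
  filter_upwards [eventually_all.2 hT, hρ.eventually_lt_const (show 0 < r / 4 by positivity),
    Metric.tendsto_nhds.1 hz (r / 4) (by positivity)] with k hk hkρ hkz
  rw [dist_eq_norm] at hkz
  have hnoiseavg : ∀ p, n k ≤ p → p < ℓ k → ∑ m ∈ Finset.Icc (n k) p, S.γ m ≤ T →
      ‖avg (fun i => ∑ m ∈ Finset.Icc (n k) p, S.γ m • ε i (m + 1))‖ ≤ δ / 2 * T :=
    fun p h1 h2 h3 => norm_avg_le hN fun i => hk i p h1 h2 h3
  have hcrude : ∀ p, n k ≤ p → p < ℓ k → ∑ m ∈ Finset.Icc (n k) p, S.γ m ≤ T →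
      ‖avg (fun i => x i (p + 1)) - avg (fun i => x i (n k))‖ ≤ (C + δ) * T := by
    intro p h1 h2 h3
    rw [(hreg k).avg_sub_eq hnet h1 h2]
    have h4 : ‖∑ m ∈ Finset.Icc (n k) p, S.γ m • avg (fun i => S.f i (x i m))‖
        ≤ (∑ m ∈ Finset.Icc (n k) p, S.γ m) * C := by
      refine norm_sum_step_smul_le hstep.1 fun m hm => norm_avg_le hN fun i => hC i _ ?_
      rw [Finset.mem_Icc] at hm
      exact (hreg k).norm_le m hm.1 (by omega) i
    have h5 := mul_le_mul_of_nonneg_right h3 hC0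
    have h6 := norm_add_le (∑ m ∈ Finset.Icc (n k) p, S.γ m • avg (fun i => S.f i (x i m)))
      (avg (fun i => ∑ m ∈ Finset.Icc (n k) p, S.γ m • ε i (m + 1)))
    nlinarith [hnoiseavg p h1 h2 h3, mul_pos hδ hT0]
  intro p h1 h2 h3
  have hclose : ∀ m ∈ Finset.Icc (n k) p, ∀ i, ‖x i m - z‖ < r := by
    intro m hm i
    rw [Finset.mem_Icc] at hm
    have h4 : ‖avg (fun i => x i m) - avg (fun i => x i (n k))‖ ≤ (C + δ) * T := by
      rcases hm.1.eq_or_lt with h | h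
      · rw [← h, sub_self, norm_zero]; positivity
      · obtain ⟨q, rfl⟩ : ∃ q, m = q + 1 := ⟨m - 1, by omega⟩
        refine hcrude q (by omega) (by omega) (le_trans ?_ h3)
        exact Finset.sum_le_sum_of_subset_of_nonneg (Finset.Icc_subset_Icc_right (by omega))
          fun m _ _ => (hstep.1 m).le
    have h5 := (hreg k).near m hm.1 (by omega) i
    have h6 : x i m - z = (x i m - avg (fun i => x i m))
        + (avg (fun i => x i m) - avg (fun i => x i (n k)))
        + (avg (fun i => x i (n k)) - z) := by abel
    rw [h6]
    refine norm_add₃_le.trans_lt ?_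
    linarith
  have hsplit : avg (fun i => x i (p + 1)) - avg (fun i => x i (n k))
      - (∑ m ∈ Finset.Icc (n k) p, S.γ m) • S.meanFun z
      = ∑ m ∈ Finset.Icc (n k) p, S.γ m • (avg (fun i => S.f i (x i m)) - S.meanFun z)
        + avg (fun i => ∑ m ∈ Finset.Icc (n k) p, S.γ m • ε i (m + 1)) := by
    rw [(hreg k).avg_sub_eq hnet h1 h2]
    simp only [smul_sub, Finset.sum_sub_distrib, Finset.sum_smul]
    abel
  rw [hsplit]
  have h4 : ‖∑ m ∈ Finset.Icc (n k) p, S.γ m • (avg (fun i => S.f i (x i m)) - S.meanFun z)‖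
      ≤ (∑ m ∈ Finset.Icc (n k) p, S.γ m) * (δ / 2) := by
    refine norm_sum_step_smul_le hstep.1 fun m hm => ?_
    have h5 : avg (fun i => S.f i (x i m)) - S.meanFun z
        = avg (fun i => S.f i (x i m) - S.f i z) := by rw [avg_sub]; rfl
    rw [h5]
    exact norm_avg_le hN fun i => (hfr _ (hclose m hm i) i).le
  have h5 := mul_le_mul_of_nonneg_right h3 (show 0 ≤ δ / 2 by positivity)
  refine (norm_add_le _ _).trans ?_
  linarith [hnoiseavg p h1 h2 h3]

theorem eventually_norm_avg_sub_le {r : ℝ} (hr : 0 < r) :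
    ∀ᶠ T in 𝓝[>] (0 : ℝ), ∀ᶠ k in atTop, ∀ p, n k ≤ p → p < ℓ k →
      ∑ m ∈ Finset.Icc (n k) p, S.γ m ≤ T → ‖avg (fun i => x i (p + 1)) - z‖ ≤ r := by
  have hTr : ∀ᶠ T in 𝓝[>] (0 : ℝ), (1 + ‖S.meanFun z‖) * T < r / 2 := by
    have : Tendsto (fun T : ℝ => (1 + ‖S.meanFun z‖) * T) (𝓝[>] 0)
        (𝓝 ((1 + ‖S.meanFun z‖) * 0)) :=
      (continuous_const.mul continuous_id).continuousAt.tendsto.mono_left nhdsWithin_le_nhds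
    exact this.eventually_lt_const (by simpa using hr)
  filter_upwards [eventually_norm_avg_sub_sub_le hN hstep hcont hnet hnoise hn hnℓ hreg hρ hz
    one_pos, hTr] with T hT hTr
  filter_upwards [hT, Metric.tendsto_nhds.1 hz (r / 2) (by positivity)] with k hk hkz p h1 h2 h3
  rw [dist_eq_norm] at hkz
  have h4 := hk p h1 h2 h3
  have h0 : 0 ≤ ∑ m ∈ Finset.Icc (n k) p, S.γ m := Finset.sum_nonneg fun m _ => (hstep.1 m).le
  have h5 : ‖(∑ m ∈ Finset.Icc (n k) p, S.γ m) • S.meanFun z‖ ≤ T * ‖S.meanFun z‖ := by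
    rw [norm_smul, Real.norm_of_nonneg h0]
    exact mul_le_mul_of_nonneg_right h3 (norm_nonneg _)
  have h6 : avg (fun i => x i (p + 1)) - z
      = (avg (fun i => x i (p + 1)) - avg (fun i => x i (n k))
        - (∑ m ∈ Finset.Icc (n k) p, S.γ m) • S.meanFun z)
        + (∑ m ∈ Finset.Icc (n k) p, S.γ m) • S.meanFun z
        + (avg (fun i => x i (n k)) - z) := by abel
  rw [h6]
  refine norm_add₃_le.trans ?_
  linarith

/-- If the mean field at `z` points in a direction of descent of `v`, the value of `v` at the
average decreases along regular stretches starting near `z`. -/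
theorem exists_eventually_apply_avg_le {v : Vec l → ℝ} (hv : ContDiff ℝ 1 v)
    (hdesc : inner ℝ (S.meanFun z) (gradient v z) < 0) :
    ∃ κ > 0, ∀ᶠ T in 𝓝[>] (0 : ℝ), ∀ᶠ k in atTop, ∀ p, n k ≤ p → p < ℓ k →
      ∑ m ∈ Finset.Icc (n k) p, S.γ m ≤ T → T / 2 ≤ ∑ m ∈ Finset.Icc (n k) p, S.γ m →
      v (avg (fun i => x i (p + 1))) ≤ v (avg (fun i => x i (n k))) - κ * T := by
  set g := S.meanFun z with hg
  set α := -inner ℝ g (gradient v z) with hα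
  have hα0 : 0 < α := by linarith
  set c₁ := α / (8 * (‖g‖ + 1)) with hc₁
  set c₂ := min 1 (α / (8 * (‖gradient v z‖ + 1))) with hc₂
  have hc₁0 : 0 < c₁ := by positivity
  have hc₂0 : 0 < c₂ := by positivity
  have hstrict : HasStrictFDerivAt v (fderiv ℝ v z) z :=
    hv.contDiffAt.hasStrictFDerivAt one_ne_zero
  have hgrad : ∀ w, fderiv ℝ v z w = inner ℝ (gradient v z) w := by
    intro w
    rw [gradient, InnerProductSpace.toDual_symm_apply]
  obtain ⟨r, hr, hvr⟩ : ∃ r > 0, ∀ w w', ‖w - z‖ < r → ‖w' - z‖ < r →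
      ‖v w - v w' - inner ℝ (gradient v z) (w - w')‖ ≤ c₁ * ‖w - w'‖ := by
    have h1 := hstrict.isLittleO.def hc₁0
    rw [nhds_prod_eq] at h1
    obtain ⟨P, hP, Q, hQ, hPQ⟩ := eventually_prod_iff.1 h1
    obtain ⟨r, hr, h2⟩ := Metric.eventually_nhds_iff.1 (hP.and hQ)
    refine ⟨r, hr, fun w w' hw hw' => ?_⟩
    have := hPQ (h2 (y := w) (by rwa [dist_eq_norm])).1 (h2 (y := w') (by rwa [dist_eq_norm])).2
    simpa only [hgrad] using this
  refine ⟨α / 4, by positivity, ?_⟩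
  filter_upwards [eventually_norm_avg_sub_sub_le hN hstep hcont hnet hnoise hn hnℓ hreg hρ hz
    hc₂0, eventually_norm_avg_sub_le hN hstep hcont hnet hnoise hn hnℓ hreg hρ hz
    (half_pos hr), self_mem_nhdsWithin] with T hT hTr hT0
  replace hT0 : 0 < T := hT0
  filter_upwards [hT, hTr, Metric.tendsto_nhds.1 hz r hr] with k hk hkr hkz p h1 h2 h3 h4
  rw [dist_eq_norm] at hkz
  have h5 := hk p h1 h2 h3
  have h6 := hvr _ _ ((hkr p h1 h2 h3).trans_lt (half_lt_self hr)) hkz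
  set s := ∑ m ∈ Finset.Icc (n k) p, S.γ m
  set d := avg (fun i => x i (p + 1)) - avg (fun i => x i (n k))
  have hs0 : 0 ≤ s := Finset.sum_nonneg fun m _ => (hstep.1 m).le
  clear_value s d
  have h7 : inner ℝ (gradient v z) d ≤ -(s * α) + ‖gradient v z‖ * (c₂ * T) := by
    have h8 : inner ℝ (gradient v z) d
        = s * inner ℝ (gradient v z) g + inner ℝ (gradient v z) (d - s • g) := by
      rw [inner_sub_right, inner_smul_right]; ring
    rw [h8, real_inner_comm g, hα]
    have h9 := real_inner_le_norm (gradient v z) (d - s • g)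
    have h10 := mul_le_mul_of_nonneg_left h5 (norm_nonneg (gradient v z))
    linarith
  have h8 : ‖d‖ ≤ (‖g‖ + 1) * T := by
    have h9 : ‖s • g‖ ≤ T * ‖g‖ := by
      rw [norm_smul, Real.norm_of_nonneg hs0]
      exact mul_le_mul_of_nonneg_right h3 (norm_nonneg _)
    have h10 : c₂ * T ≤ 1 * T := mul_le_mul_of_nonneg_right (min_le_left _ _) hT0.le
    have h11 := norm_add_le (d - s • g) (s • g)
    rw [sub_add_cancel] at h11
    linarith
  have h9 : c₁ * ‖d‖ ≤ α / 8 * T := by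
    calc c₁ * ‖d‖ ≤ c₁ * ((‖g‖ + 1) * T) := mul_le_mul_of_nonneg_left h8 hc₁0.le
      _ = _ := by rw [hc₁]; field_simp
  have h10 : ‖gradient v z‖ * (c₂ * T) ≤ α / 8 * T := by
    calc ‖gradient v z‖ * (c₂ * T)
        ≤ (‖gradient v z‖ + 1) * (α / (8 * (‖gradient v z‖ + 1)) * T) := by
          have : c₂ ≤ α / (8 * (‖gradient v z‖ + 1)) := min_le_right _ _
          gcongr
          linarith
      _ = _ := by field_simp
  have h11 : T / 2 * α ≤ s * α := mul_le_mul_of_nonneg_right h4 hα0.le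
  have h12 := (Real.norm_eq_abs _ ▸ le_abs_self _).trans h6
  linarith

end Drift
end DSAAWET

/-! ### Sequences with vanishing steps -/

section VanishingSteps

variable {E : Type*} [MetricSpace E] [ProperSpace E] {y : ℕ → E} {s : Set E}

theorem tendsto_infDist_setOf_mapClusterPt (hs : Bornology.IsBounded s)
    (hy : ∀ᶠ k in atTop, y k ∈ s) :
    Tendsto (fun k => Metric.infDist (y k) {z | MapClusterPt z atTop y}) atTop (𝓝 0) := by
  by_contra hcon
  have h1 : ∃ δ > 0, ∃ᶠ k in atTop, δ ≤ Metric.infDist (y k) {z | MapClusterPt z atTop y} := by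
    by_contra! h
    refine hcon (Metric.tendsto_nhds.2 fun δ hδ => ?_)
    filter_upwards [h δ hδ] with k hk
    rw [Real.dist_0_eq_abs, abs_of_nonneg Metric.infDist_nonneg]
    exact hk
  obtain ⟨δ, hδ, hfreq⟩ := h1
  obtain ⟨φ, hφ, hφ'⟩ := extraction_of_frequently_atTop (hfreq.and_eventually hy)
  obtain ⟨z, -, ψ, hψ, hz⟩ := tendsto_subseq_of_bounded hs fun k => (hφ' k).2
  have hzc : MapClusterPt z atTop y :=
    MapClusterPt.of_comp (hφ.tendsto_atTop.comp hψ.tendsto_atTop) hz.mapClusterPt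
  have h2 : Tendsto (fun k => Metric.infDist (y (φ (ψ k))) {z | MapClusterPt z atTop y}) atTop
      (𝓝 (Metric.infDist z {z | MapClusterPt z atTop y})) :=
    ((Metric.continuous_infDist_pt _).tendsto z).comp hz
  have h3 := ge_of_tendsto' h2 fun k => (hφ' (ψ k)).1
  rw [Metric.infDist_zero_of_mem (s := {z | MapClusterPt z atTop y}) hzc] at h3
  linarith

/-- The set of cluster points of a bounded sequence with vanishing steps is connected: such a
sequence cannot jump between the neighbourhoods of two separated parts of it. -/
theorem isConnected_setOf_mapClusterPt (hs : Bornology.IsBounded s) (hy : ∀ᶠ k in atTop, y k ∈ s)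
    (hstep : Tendsto (fun k => dist (y (k + 1)) (y k)) atTop (𝓝 0)) :
    IsConnected {z | MapClusterPt z atTop y} := by
  set Z := {z | MapClusterPt z atTop y} with hZ
  have hclosed : IsClosed Z := isClosed_setOfPred_clusterPt
  have hsub : Z ⊆ closure s := fun z hz => isClosed_closure.mem_of_mapClusterPt hz
    (hy.mono fun k hk => subset_closure hk)
  have hcompact : IsCompact Z := hs.isCompact_closure.of_isClosed_subset hclosed hsub
  refine ⟨?_, isPreconnected_closed_iff.2 fun A B hA hB hAB hZA hZB => ?_⟩
  · obtain ⟨z, -, φ, hφ, hz⟩ := tendsto_subseq_of_frequently_bounded hs hy.frequently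
    exact ⟨z, MapClusterPt.of_comp hφ.tendsto_atTop hz.mapClusterPt⟩
  · by_contra hempty
    have hdisj : Disjoint (Z ∩ A) (Z ∩ B) := Set.disjoint_left.2 fun z hz1 hz2 =>
      hempty ⟨z, hz1.1, hz1.2, hz2.2⟩
    obtain ⟨δ, hδ, hthick⟩ := hdisj.exists_thickenings (hcompact.inter_right hA)
      (hclosed.inter hB)
    have hhalf : ∀ K : Set E, Metric.thickening (δ / 2) K ⊆ Metric.thickening δ K := fun K =>
      Metric.thickening_mono (half_le_self hδ.le) K
    have hcover : ∀ᶠ k in atTop, y k ∈ Metric.thickening (δ / 2) (Z ∩ A)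
        ∨ y k ∈ Metric.thickening (δ / 2) (Z ∩ B) := by
      filter_upwards [(tendsto_infDist_setOf_mapClusterPt hs hy).eventually_lt_const
        (half_pos hδ)] with k hk
      obtain ⟨z, hz, hdist⟩ := (Metric.infDist_lt_iff ⟨_, hZA.some_mem.1⟩).1 hk
      rcases hAB hz with h | h
      · exact Or.inl (Metric.mem_thickening_iff.2 ⟨z, ⟨hz, h⟩, hdist⟩)
      · exact Or.inr (Metric.mem_thickening_iff.2 ⟨z, ⟨hz, h⟩, hdist⟩)
    have hfreq : ∀ K : Set E, (Z ∩ K).Nonempty →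
        ∃ᶠ k in atTop, y k ∈ Metric.thickening (δ / 2) (Z ∩ K) := fun K hK =>
      (mapClusterPt_iff_frequently.1 hK.some_mem.1) _
        (Metric.isOpen_thickening.mem_nhds (Metric.self_subset_thickening (half_pos hδ) _
          hK.some_mem))
    obtain ⟨K, hK⟩ := eventually_atTop.1 (hcover.and (hstep.eventually_lt_const (half_pos hδ)))
    obtain ⟨k, hkK, hk⟩ := frequently_atTop.1 (hfreq A hZA) K
    have hstay : ∀ j ≥ k, y j ∈ Metric.thickening (δ / 2) (Z ∩ A) := by
      intro j hj
      induction j, hj using Nat.le_induction with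
      | base => exact hk
      | succ j hj ih =>
        refine (hK (j + 1) (by omega)).1.resolve_right fun h => ?_
        obtain ⟨z, hz, hdist⟩ := Metric.mem_thickening_iff.1 ih
        refine Set.disjoint_left.1 hthick (Metric.mem_thickening_iff.2 ⟨z, hz, ?_⟩) (hhalf _ h)
        linarith [dist_triangle (y (j + 1)) (y j) z, (hK j (by omega)).2]
    obtain ⟨j, hj, hjB⟩ := frequently_atTop.1 (hfreq B hZB) k
    exact Set.disjoint_left.1 hthick (hhalf _ (hstay j hj)) (hhalf _ hjB)

end VanishingSteps

namespace DSAAWET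

variable {N l : ℕ} {S : DSAAWET N l} {x ε : Fin N → ℕ → Vec l} {R : ℝ}

/-! ### Upcrossings of the Lyapunov function -/

theorem continuous_meanFun (hcont : ∀ i, Continuous (S.f i)) : Continuous S.meanFun :=
  (continuous_finsetSum _ fun i _ => hcont i).const_smul (1 / (N : ℝ))

theorem isClosed_rootSet (hcont : ∀ i, Continuous (S.f i)) : IsClosed S.rootSet :=
  isClosed_singleton.preimage (continuous_meanFun hcont)

theorem inner_meanFun_gradient_neg (hJ : S.rootSet.Nonempty) (hcont : ∀ i, Continuous (S.f i))
    {v : Vec l → ℝ} (hv : ∀ δ Δ : ℝ, 0 < δ → δ < Δ → ∃ α : ℝ, 0 < α ∧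
      ∀ x, δ ≤ Metric.infDist x S.rootSet → Metric.infDist x S.rootSet ≤ Δ →
        inner ℝ (S.meanFun x) (gradient v x) ≤ -α) {z : Vec l} (hz : z ∉ S.rootSet) :
    inner ℝ (S.meanFun z) (gradient v z) < 0 := by
  have h := ((isClosed_rootSet hcont).notMem_iff_infDist_pos hJ).1 hz
  obtain ⟨α, hα, h1⟩ := hv _ _ (half_pos h) (half_lt_self h)
  linarith [h1 z (half_le_self h.le) le_rfl]

/-- While the arguments of the local functions stay bounded, the increments vanish uniformly. -/
theorem eventually_norm_step_le (hstep : S.StepSizeCondition) (hcont : ∀ i, Continuous (S.f i))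
    (hε : ∀ i, Tendsto (fun k => S.γ k • ε i (k + 1)) atTop (𝓝 0)) (R : ℝ) {β : ℝ} (hβ : 0 < β) :
    ∀ᶠ k in atTop, ∀ i w, ‖w‖ ≤ R → ‖S.γ k • (S.f i w + ε i (k + 1))‖ ≤ β := by
  obtain ⟨C, hC0, hC⟩ := exists_norm_f_le hcont R
  have h1 : Tendsto (fun k => S.γ k * C) atTop (𝓝 0) := by simpa using hstep.2.1.mul_const C
  have h2 : ∀ᶠ k in atTop, ∀ i, ‖S.γ k • ε i (k + 1)‖ < β / 2 := eventually_all.2 fun i => by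
    simpa [dist_eq_norm] using Metric.tendsto_nhds.1 (hε i) (β / 2) (half_pos hβ)
  filter_upwards [h1.eventually_lt_const (half_pos hβ), h2] with k hk1 hk2 i w hw
  rw [smul_add]
  refine (norm_add_le _ _).trans ?_
  rw [norm_smul, Real.norm_of_nonneg (hstep.1 k).le]
  have := mul_le_mul_of_nonneg_left (hC i w hw) (hstep.1 k).le
  linarith [hk2 i]

/-- The average cannot make infinitely many upcrossings, along ever later and ever more
synchronized regular stretches in a fixed ball, from a value `a` of `v` that is not attained at
a root: the starting points would accumulate at a point where `v` equals `a`, and from there the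
mean field leads downwards. -/
theorem false_of_upcrossings (hN : 0 < N) (hstep : S.StepSizeCondition)
    (hcont : ∀ i, Continuous (S.f i)) (hnet : S.NetworkCondition)
    (hnoise : ∀ i, S.NoiseCondition (ε i) (x i)) {v : Vec l → ℝ} (hv : ContDiff ℝ 1 v)
    (hdesc : ∀ z ∉ S.rootSet, inner ℝ (S.meanFun z) (gradient v z) < 0) {a b : ℝ} (hab : a < b)
    (ha : a ∉ v '' S.rootSet)
    (hup : ∀ ρ > 0, ∃ᶠ n in atTop, ∃ ℓ, n < ℓ ∧ S.RegularOn x ε R ρ n ℓ ∧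
      v (avg fun i => x i n) ≤ a ∧ (∀ q, n < q → q ≤ ℓ → a < v (avg fun i => x i q)) ∧
      b ≤ v (avg fun i => x i ℓ)) : False := by
  obtain ⟨φ, hφ, hφ'⟩ := extraction_forall_of_frequently
    fun k : ℕ => hup (1 / ((k : ℝ) + 1)) (by positivity)
  choose ℓ hlt hreg hva hvgt hvb using hφ'
  have hbdd : ∀ k, avg (fun i => x i (φ k)) ∈ Metric.closedBall (0 : Vec l) R := fun k => by
    rw [mem_closedBall_zero_iff]
    exact norm_avg_le hN fun i => (hreg k).norm_le _ le_rfl (hlt k).le i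
  obtain ⟨z, -, ψ, hψ, hz⟩ := tendsto_subseq_of_bounded Metric.isBounded_closedBall hbdd
  have hn := hφ.comp hψ
  have hρ : Tendsto (fun k => 1 / ((ψ k : ℝ) + 1)) atTop (𝓝 0) :=
    tendsto_one_div_add_atTop_nhds_zero_nat.comp hψ.tendsto_atTop
  have hreg' : ∀ k, S.RegularOn x ε R (1 / ((ψ k : ℝ) + 1)) ((φ ∘ ψ) k) ((ℓ ∘ ψ) k) :=
    fun k => hreg (ψ k)
  have hlt' : ∀ k, (φ ∘ ψ) k < (ℓ ∘ ψ) k := fun k => hlt (ψ k)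
  have hnear := fun {r : ℝ} (hr : 0 < r) => eventually_norm_avg_sub_le hN hstep hcont hnet hnoise
    hn hlt' hreg' hρ hz hr
  have hγ := hstep.2.1.comp hn.tendsto_atTop
  have hvz : v z = a := by
    refine le_antisymm ?_ ?_
    · exact le_of_tendsto' ((hv.continuous.tendsto z).comp hz) fun k => hva (ψ k)
    · have h1 : Tendsto (fun k => avg (fun i => x i ((φ ∘ ψ) k + 1))) atTop (𝓝 z) := by
        refine Metric.tendsto_nhds.2 fun r hr => ?_
        obtain ⟨T, hT, hT0⟩ := ((hnear (half_pos hr)).and self_mem_nhdsWithin).exists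
        filter_upwards [hT, hγ.eventually_lt_const hT0] with k hk hkγ
        rw [dist_eq_norm]
        refine (hk _ le_rfl (hlt' k) ?_).trans_lt (half_lt_self hr)
        rw [Finset.Icc_self, Finset.sum_singleton]
        exact hkγ.le
      exact ge_of_tendsto' ((hv.continuous.tendsto z).comp h1)
        fun k => (hvgt (ψ k) _ (Nat.lt_succ_self _) (hlt (ψ k))).le
  have hzJ : z ∉ S.rootSet := fun h => ha ⟨z, h, hvz⟩
  obtain ⟨κ, hκ, hdec⟩ := exists_eventually_apply_avg_le hN hstep hcont hnet hnoise hn hlt' hreg'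
    hρ hz hv (hdesc z hzJ)
  obtain ⟨r, hr, hvr⟩ : ∃ r > 0, ∀ w, ‖w - z‖ < r → v w < b := by
    obtain ⟨r, hr, h⟩ := Metric.eventually_nhds_iff.1
      ((hv.continuous.tendsto z).eventually_lt_const (hvz ▸ hab))
    exact ⟨r, hr, fun w hw => h (by rwa [dist_eq_norm])⟩
  obtain ⟨T, ⟨hT1, hT2⟩, hT0⟩ :=
    ((hdec.and (hnear (half_pos hr))).and self_mem_nhdsWithin).exists
  replace hT0 : 0 < T := hT0
  obtain ⟨K, hK⟩ := eventually_atTop.1 (hstep.2.1.eventually_lt_const (half_pos hT0))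
  obtain ⟨k, hk1, hk2, hkK⟩ := (hT1.and (hT2.and (hn.tendsto_atTop.eventually_ge_atTop K))).exists
  obtain ⟨p, hp, hp1, hp2⟩ := hstep.exists_sum_Icc_mem (n := (φ ∘ ψ) k) (T := T)
    fun m hm => (hK m (hkK.trans hm)).le
  have hwin : ∀ p, (φ ∘ ψ) k ≤ p → ∑ m ∈ Finset.Icc ((φ ∘ ψ) k) p, S.γ m ≤ T →
      p + 1 < (ℓ ∘ ψ) k := by
    have hne : ∀ p, (φ ∘ ψ) k ≤ p → p < (ℓ ∘ ψ) k →
        ∑ m ∈ Finset.Icc ((φ ∘ ψ) k) p, S.γ m ≤ T → p + 1 < (ℓ ∘ ψ) k := by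
      intro p h1 h2 h3
      refine lt_of_le_of_ne h2 fun heq => ?_
      have h4 := hvr _ ((hk2 p h1 h2 h3).trans_lt (half_lt_self hr))
      rw [heq] at h4
      exact absurd (hvb (ψ k)) (not_le.2 h4)
    intro p hp
    induction p, hp using Nat.le_induction with
    | base => exact fun h => hne _ le_rfl (hlt' k) h
    | succ p hp ih =>
      intro h
      refine hne _ (by omega) (ih (le_trans ?_ h)) h
      exact Finset.sum_le_sum_of_subset_of_nonneg (Finset.Icc_subset_Icc_right (by omega))
        fun m _ _ => (hstep.1 m).le
  have hlt2 := hwin p hp hp2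
  have h1 := hk1 p hp (by omega) hp2 hp1
  have h2 := hvgt (ψ k) (p + 1) (Nat.lt_succ_of_le hp) hlt2.le
  have h3 := hva (ψ k)
  have h4 := mul_pos hκ hT0
  simp only [Function.comp_apply] at h1
  linarith

theorem exists_last_le {u : ℕ → ℝ} {a : ℝ} {n ℓ : ℕ} (hnℓ : n ≤ ℓ) (hn : u n ≤ a)
    (hℓ : a < u ℓ) :
    ∃ p, n ≤ p ∧ p < ℓ ∧ u p ≤ a ∧ ∀ q, p < q → q ≤ ℓ → a < u q := by
  induction ℓ, hnℓ using Nat.le_induction with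
  | base => exact absurd hn (not_le.2 hℓ)
  | succ ℓ h ih =>
    by_cases hc : u ℓ ≤ a
    · refine ⟨ℓ, h, Nat.lt_succ_self _, hc, fun q h1 h2 => ?_⟩
      obtain rfl : q = ℓ + 1 := by omega
      exact hℓ
    · obtain ⟨p, h1, h2, h3, h4⟩ := ih (not_le.1 hc)
      refine ⟨p, h1, by omega, h3, fun q h5 h6 => ?_⟩
      rcases Nat.lt_or_ge ℓ q with h7 | h7
      · obtain rfl : q = ℓ + 1 := by omega
        exact hℓ
      · exact h4 q h5 h7

end DSAAWET

/-! ### Finiteness of the number of truncations -/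

namespace DSAAWET

variable {N l : ℕ} {S : DSAAWET N l} {x₀ : Fin N → Vec l} {ε : Fin N → ℕ → Vec l}

theorem truncNum_mono (S : DSAAWET N l) (x₀ : Fin N → Vec l) (ε : Fin N → ℕ → Vec l) (i : Fin N) :
    Monotone (S.truncNum x₀ ε i) :=
  monotone_nat_of_le_succ fun k => (S.truncNum_le_hatNum x₀ ε (S.adj_self k i)).trans
    (S.hatNum_le_truncNum_succ x₀ ε i k)

/-- A stretch of constant level after a reset: from time `τ`, at which all auxiliary estimates
are at the reset point, to time `τ + t` the level is constant, the auxiliary estimates stay in the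
ball of radius `R` until the last step, and in this ball the increments are at most `β`. -/
structure ResetStretch (S : DSAAWET N l) (x₀ : Fin N → Vec l) (ε : Fin N → ℕ → Vec l)
    (R β : ℝ) (τ t : ℕ) : Prop where
  reset : ∀ i, S.auxEst x₀ ε i τ = S.xstar
  level_eq : ∀ s ≤ t, S.level x₀ ε (τ + s) = S.level x₀ ε τ
  norm_le : ∀ s < t, ∀ i, ‖S.auxEst x₀ ε i (τ + s)‖ ≤ R
  step_le : ∀ k ≥ τ, ∀ i w, ‖w‖ ≤ R → ‖S.γ k • (S.f i w + ε i (k + 1))‖ ≤ β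

namespace ResetStretch

variable {R β : ℝ} {τ t : ℕ}

theorem mono (h : S.ResetStretch x₀ ε R β τ t) {s : ℕ} (hs : s ≤ t) :
    S.ResetStretch x₀ ε R β τ s where
  reset := h.reset
  level_eq r hr := h.level_eq r (hr.trans hs)
  norm_le r hr := h.norm_le r (hr.trans_le hs)
  step_le := h.step_le

theorem level_succ (h : S.ResetStretch x₀ ε R β τ t) {s : ℕ} (hs : s < t) :
    S.level x₀ ε (τ + s + 1) = S.level x₀ ε (τ + s) := by
  rw [add_assoc, h.level_eq (s + 1) hs, h.level_eq s hs.le]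

theorem norm_auxEst_sub_xstar_le (hW : ∀ k, S.W k ∈ Matrix.rowStochastic ℝ (Fin N)) (hβ : 0 ≤ β)
    (h : S.ResetStretch x₀ ε R β τ t) (i : Fin N) :
    ‖S.auxEst x₀ ε i (τ + t) - S.xstar‖ ≤ t * β := by
  induction t generalizing i with
  | zero => simp [h.reset]
  | succ t ih =>
    have ih' := ih (h.mono (Nat.le_succ t))
    have hrow := Matrix.mem_rowStochastic_iff_sum.1 (hW (τ + t))
    by_cases hi : S.truncNum x₀ ε i (τ + t) = S.level x₀ ε (τ + t)
    · rw [← add_assoc, (S.auxEst_succ_of_truncNum_eq x₀ ε hi (h.level_succ (Nat.lt_succ_self t))).2,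
        add_sub_right_comm]
      have h1 := norm_sum_smul_sub_le (hrow.1 i) (hrow.2 i) ih'
      have h2 := h.step_le (τ + t) (by omega) i _ (h.norm_le t (Nat.lt_succ_self t) i)
      refine (norm_add_le _ _).trans ?_
      push_cast
      linarith
    · rw [← add_assoc, S.auxEst_succ_of_truncNum_ne x₀ ε hi (h.level_succ (Nat.lt_succ_self t)),
        sub_self, norm_zero]
      positivity

variable {L : ℕ} {c : ℝ}

/-- All agents reach the level within `L` steps. -/
theorem truncNum_eq_level (hW : ∀ k, S.W k ∈ Matrix.rowStochastic ℝ (Fin N))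
    (hL : ∀ q i j, 0 < transition S.W q L i j) (h : S.ResetStretch x₀ ε R β τ t) (ht : L ≤ t)
    (i : Fin N) : S.truncNum x₀ ε i (τ + t) = S.level x₀ ε (τ + t) := by
  refine le_antisymm (S.truncNum_le_level x₀ ε i _) ?_
  rw [h.level_eq t le_rfl]
  exact (S.level_le_truncNum_add x₀ ε hW hL i τ).trans (S.truncNum_mono x₀ ε i (by omega))

/-- The auxiliary estimates follow the averaging scheme up to small perturbations. Agents below
the level, which are held at the reset point, exist only during the first `L` steps, when all
auxiliary estimates are still close to the reset point. -/
theorem norm_auxEst_succ_sub_le (hW : ∀ k, S.W k ∈ Matrix.rowStochastic ℝ (Fin N))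
    (hL : ∀ q i j, 0 < transition S.W q L i j) (hβ : 0 ≤ β)
    (h : S.ResetStretch x₀ ε R β τ t) {s : ℕ} (hs : s < t) (i : Fin N) :
    ‖S.auxEst x₀ ε i (τ + s + 1) - ∑ j, S.W (τ + s) i j • S.auxEst x₀ ε j (τ + s)‖
      ≤ (L + 1) * β := by
  have hrow := Matrix.mem_rowStochastic_iff_sum.1 (hW (τ + s))
  by_cases hi : S.truncNum x₀ ε i (τ + s) = S.level x₀ ε (τ + s)
  · rw [(S.auxEst_succ_of_truncNum_eq x₀ ε hi (h.level_succ hs)).2, add_sub_cancel_left]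
    have h1 := h.step_le (τ + s) (by omega) i _ (h.norm_le s hs i)
    have h2 : 0 ≤ (L : ℝ) * β := by positivity
    linarith
  · rw [S.auxEst_succ_of_truncNum_ne x₀ ε hi (h.level_succ hs), norm_sub_rev]
    have hsL : s < L := by
      by_contra hc
      exact hi ((h.mono hs.le).truncNum_eq_level hW hL (not_lt.1 hc) i)
    refine (norm_sum_smul_sub_le (hrow.1 i) (hrow.2 i)
      fun j => (h.mono hs.le).norm_auxEst_sub_xstar_le hW hβ j).trans ?_
    have : (s : ℝ) ≤ L + 1 := by exact_mod_cast (by omega : s ≤ L + 1)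
    gcongr

theorem norm_auxEst_sub_avg_le (hN : 0 < N) (hW : ∀ k, S.W k ∈ Matrix.rowStochastic ℝ (Fin N))
    (hL0 : 0 < L) (hc : 0 < c) (hL : ∀ q i j, c ≤ transition S.W q L i j) (hβ : 0 ≤ β)
    (h : S.ResetStretch x₀ ε R β τ t) (i : Fin N) :
    ‖S.auxEst x₀ ε i (τ + t) - avg (fun j => S.auxEst x₀ ε j (τ + t))‖
      ≤ 2 * L * ((L + 1) * β) / c ^ 2 := by
  rw [norm_sub_rev]
  refine norm_avg_sub_le hN fun j => ?_
  have h1 := norm_sub_le_of_perturbed_averaging hW hL0 hc hL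
    (X := fun q i => S.auxEst x₀ ε i q) (β := (L + 1) * β) (D := 0) (τ := τ) (by positivity)
    (fun i j => by simp [h.reset]) t ?_ j i
  · simpa using h1
  · intro q hq1 hq2 i
    obtain ⟨s, rfl⟩ := Nat.exists_eq_add_of_le hq1
    exact h.norm_auxEst_succ_sub_le hW (fun q i j => hc.trans_le (hL q i j)) hβ (by omega) i

theorem norm_avg_succ_sub_le (hN : 0 < N) (hnet : S.NetworkCondition)
    (hL : ∀ q i j, 0 < transition S.W q L i j) (hβ : 0 ≤ β)
    (h : S.ResetStretch x₀ ε R β τ (t + 1)) :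
    ‖avg (fun i => S.auxEst x₀ ε i (τ + t + 1)) - avg (fun i => S.auxEst x₀ ε i (τ + t))‖
      ≤ (L + 1) * β := by
  rw [← avg_sum_smul (hnet.1 (τ + t)) (fun i => S.auxEst x₀ ε i (τ + t)), ← avg_sub]
  exact norm_avg_le hN fun i =>
    h.norm_auxEst_succ_sub_le hnet.mem_rowStochastic hL hβ (Nat.lt_succ_self t) i

/-- As long as the bound of the level exceeds `R + β`, the level cannot rise. -/
theorem level_succ_eq (hW : ∀ k, S.W k ∈ Matrix.rowStochastic ℝ (Fin N))
    (h : S.ResetStretch x₀ ε R β τ t) (ht : ∀ i, ‖S.auxEst x₀ ε i (τ + t)‖ ≤ R)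
    (hM : R + β ≤ S.M (S.level x₀ ε τ)) : S.level x₀ ε (τ + t + 1) = S.level x₀ ε τ := by
  rw [← h.level_eq t le_rfl] at hM ⊢
  refine le_antisymm (not_lt.1 fun hlt => ?_) (S.level_mono x₀ ε (Nat.le_succ _))
  obtain ⟨i, hi, hcand⟩ := S.exists_candidate_of_level_lt x₀ ε hlt
  rw [S.candidate_of_truncNum_eq x₀ ε hi] at hcand
  have hrow := Matrix.mem_rowStochastic_iff_sum.1 (hW (τ + t))
  have h1 := norm_sum_smul_le (hrow.1 i) (hrow.2 i) ht
  have h2 := h.step_le (τ + t) (by omega) i _ (ht i)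
  have h3 := norm_add_le (∑ j, S.W (τ + t) i j • S.auxEst x₀ ε j (τ + t))
    (S.γ (τ + t) • (S.f i (S.auxEst x₀ ε i (τ + t)) + ε i (τ + t + 1)))
  linarith

end ResetStretch

/-- A value of `v` below the infimum over a sphere is exceeded by a margin in an outer
neighbourhood of the sphere. -/
theorem exists_le_apply_of_norm_near {v : Vec l → ℝ} (hv : Continuous v) {c₀ b : ℝ} (hc₀ : 0 < c₀)
    (hb : b < sInf (v '' {w | ‖w‖ = c₀})) :
    ∃ ρ > 0, ∀ w, c₀ ≤ ‖w‖ → ‖w‖ < c₀ + ρ → b ≤ v w := by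
  have huc : UniformContinuousOn v (Metric.closedBall 0 (c₀ + 1)) :=
    (isCompact_closedBall _ _).uniformContinuousOn_of_continuous hv.continuousOn
  obtain ⟨ρ, hρ, h⟩ := Metric.uniformContinuousOn_iff.1 huc _ (sub_pos.2 hb)
  have hbdd : BddBelow (v '' {w | ‖w‖ = c₀}) := by
    have : {w : Vec l | ‖w‖ = c₀} = Metric.sphere 0 c₀ := by ext; simp
    rw [this]
    exact (isCompact_sphere _ _).bddBelow_image hv.continuousOn
  refine ⟨min ρ 1, by positivity, fun w hw1 hw2 => ?_⟩
  have hw0 : 0 < ‖w‖ := hc₀.trans_le hw1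
  have hnorm : ‖(c₀ / ‖w‖) • w‖ = c₀ := by
    rw [norm_smul, Real.norm_of_nonneg (by positivity), div_mul_cancel₀ _ hw0.ne']
  have hdist : dist w ((c₀ / ‖w‖) • w) = ‖w‖ - c₀ := by
    have h1 : w - (c₀ / ‖w‖) • w = (1 - c₀ / ‖w‖) • w := by rw [sub_smul, one_smul]
    have h2 : c₀ / ‖w‖ ≤ 1 := (div_le_one hw0).2 hw1
    rw [dist_eq_norm, h1, norm_smul, Real.norm_of_nonneg (by linarith), sub_mul, one_mul,
      div_mul_cancel₀ _ hw0.ne']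
  have h3 := h w (by rw [mem_closedBall_zero_iff]; linarith [min_le_right ρ 1])
    ((c₀ / ‖w‖) • w) (by rw [mem_closedBall_zero_iff, hnorm]; linarith)
    (by rw [hdist]; linarith [min_le_left ρ 1])
  have h4 : sInf (v '' {w | ‖w‖ = c₀}) ≤ v ((c₀ / ‖w‖) • w) := csInf_le hbdd ⟨_, hnorm, rfl⟩
  rw [Real.dist_eq, abs_lt] at h3
  linarith

theorem exists_reset_time (hunb : ∀ m, ∃ k, m < S.level x₀ ε k) (m : ℕ) :
    ∃ τ, S.level x₀ ε τ = m + 1 ∧ ∀ i, S.auxEst x₀ ε i τ = S.xstar := by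
  classical
  have hex : ∃ k, m < S.level x₀ ε k := hunb m
  have hspec := Nat.find_spec hex
  have hmin := fun k => Nat.find_min hex (m := k)
  generalize Nat.find hex = τ at hspec hmin
  obtain ⟨k, rfl⟩ : ∃ k, τ = k + 1 := by
    refine ⟨τ - 1, ?_⟩
    have := S.level_le x₀ ε τ
    omega
  have h1 := not_lt.1 (hmin k (Nat.lt_succ_self k))
  have h2 := S.level_succ_le x₀ ε k
  exact ⟨k + 1, by omega, fun i => S.auxEst_succ_of_level_lt x₀ ε i (by omega)⟩

/-- If the truncations never ended, then after each late reset the average would have to leave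
the ball of radius `c₀`; before the next truncation this produces a regular stretch along which `v`
crosses upwards from `a` to `b`. -/
theorem exists_upcrossing_of_unbounded (hN : 0 < N) (hstep : S.StepSizeCondition)
    (hcont : ∀ i, Continuous (S.f i)) (hnet : S.NetworkCondition)
    (hε : ∀ i, Tendsto (fun k => S.γ k • ε i (k + 1)) atTop (𝓝 0))
    (hunb : ∀ m, ∃ k, m < S.level x₀ ε k) {v : Vec l → ℝ} (hv : Continuous v) {c₀ a b : ℝ}
    (hc₀ : 0 < c₀) (hx : ‖S.xstar‖ < c₀) (hva : v S.xstar < a) (hab : a < b)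
    (hb : b < sInf (v '' {w | ‖w‖ = c₀})) {ρ : ℝ} (hρ : 0 < ρ) :
    ∃ᶠ n in atTop, ∃ ℓ, n < ℓ ∧ S.RegularOn (S.est x₀ ε) ε (c₀ + 1) ρ n ℓ ∧
      v (avg fun i => S.est x₀ ε i n) ≤ a ∧
      (∀ q, n < q → q ≤ ℓ → a < v (avg fun i => S.est x₀ ε i q)) ∧
      b ≤ v (avg fun i => S.est x₀ ε i ℓ) := by
  classical
  have hW := hnet.mem_rowStochastic
  obtain ⟨L, hL0, c, hc, hL⟩ := hnet.exists_le_transition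
  have hL' : ∀ q i j, 0 < transition S.W q L i j := fun q i j => hc.trans_le (hL q i j)
  obtain ⟨ρ₀, hρ₀, hvρ⟩ := exists_le_apply_of_norm_near hv hc₀ hb
  obtain ⟨r, hr, hvr⟩ : ∃ r > 0, ∀ w, ‖w - S.xstar‖ < r → v w < a := by
    obtain ⟨r, hr, h⟩ := Metric.eventually_nhds_iff.1
      ((hv.tendsto S.xstar).eventually_lt_const hva)
    exact ⟨r, hr, fun w hw => h (by rwa [dist_eq_norm])⟩
  -- A bound `β` on the increments so small that the resulting disagreement, the last step of the
  -- average out of the ball, and its distance from the reset point while agents lag are negligible.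
  obtain ⟨β, hβ, hβ1, hβ2, hβρ, hβρ₀, hβr⟩ : ∃ β > 0, 2 * L * ((L + 1) * β) / c ^ 2 ≤ 1 / 2 ∧
      (L + 1) * β ≤ 1 / 2 ∧ 2 * L * ((L + 1) * β) / c ^ 2 ≤ ρ ∧ (L + 1) * β < ρ₀ ∧
      (L + 1) * β < r := by
    have h1 : ∀ᶠ β in 𝓝[>] (0 : ℝ), 2 * L * ((L + 1) * β) / c ^ 2 < min (1 / 2) ρ := by
      have : Tendsto (fun β : ℝ => 2 * L * ((L + 1) * β) / c ^ 2) (𝓝[>] 0)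
          (𝓝 (2 * L * ((L + 1) * 0) / c ^ 2)) :=
        (Continuous.tendsto (by fun_prop) 0).mono_left nhdsWithin_le_nhds
      exact this.eventually_lt_const (by simpa using hρ)
    have h2 : ∀ᶠ β in 𝓝[>] (0 : ℝ), ((L : ℝ) + 1) * β < min (1 / 2) (min ρ₀ r) := by
      have : Tendsto (fun β : ℝ => ((L : ℝ) + 1) * β) (𝓝[>] 0) (𝓝 (((L : ℝ) + 1) * 0)) :=
        (Continuous.tendsto (by fun_prop) 0).mono_left nhdsWithin_le_nhds
      exact this.eventually_lt_const (by rw [mul_zero]; positivity)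
    obtain ⟨β, ⟨h1, h2⟩, hβ⟩ := ((h1.and h2).and self_mem_nhdsWithin).exists
    simp only [lt_min_iff] at h1 h2
    exact ⟨β, hβ, h1.1.le, h2.1.le, h1.2.le, h2.2.1, h2.2.2⟩
  obtain ⟨K, hK⟩ := eventually_atTop.1 (eventually_norm_step_le hstep hcont hε (c₀ + 1) hβ)
  obtain ⟨m₀, hm₀⟩ := eventually_atTop.1 (S.M_tendsto.eventually_ge_atTop (c₀ + 2))
  rw [frequently_atTop]
  intro K₀
  obtain ⟨τ, hτ, hreset⟩ := exists_reset_time hunb (max K (max m₀ K₀))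
  have hτle : max K (max m₀ K₀) < τ := by have := S.level_le x₀ ε τ; omega
  simp only [max_lt_iff] at hτle
  have hM : c₀ + 2 ≤ S.M (S.level x₀ ε τ) := hm₀ _ (by rw [hτ]; omega)
  -- The first time at which the average leaves the region below `b` inside the ball.
  have hex : ∃ s, ¬ (S.level x₀ ε (τ + s) = S.level x₀ ε τ ∧
      (∀ i, ‖S.auxEst x₀ ε i (τ + s)‖ ≤ c₀ + 1) ∧
      ‖avg (fun i => S.auxEst x₀ ε i (τ + s))‖ < c₀ ∧
      v (avg fun i => S.auxEst x₀ ε i (τ + s)) < b) := by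
    obtain ⟨k, hk⟩ := hunb (S.level x₀ ε τ)
    refine ⟨k, fun h => ?_⟩
    have := S.level_mono x₀ ε (Nat.le_add_left k τ)
    omega
  have hspec := Nat.find_spec hex
  have hmin := fun k => Nat.find_min hex (m := k)
  simp only [not_not] at hmin
  generalize Nat.find hex = s at hspec hmin
  have havg0 : avg (fun i => S.auxEst x₀ ε i τ) = S.xstar := by
    simp only [hreset, avg_const hN]
  obtain ⟨t, rfl⟩ : ∃ t, s = t + 1 := by
    refine ⟨s - 1, (Nat.succ_pred_eq_of_ne_zero fun hs => hspec ?_).symm⟩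
    subst hs
    rw [add_zero]
    refine ⟨rfl, fun i => ?_, ?_, ?_⟩
    · rw [hreset]; linarith
    · rwa [havg0]
    · rw [havg0]; linarith
  have hst0 : S.ResetStretch x₀ ε (c₀ + 1) β τ t := ⟨hreset, fun s hs => (hmin s (by omega)).1,
    fun s hs => (hmin s (by omega)).2.1, fun k hk => hK k (by omega)⟩
  have hst : S.ResetStretch x₀ ε (c₀ + 1) β τ (t + 1) := by
    refine ⟨hreset, fun s hs => ?_, fun s hs => (hmin s hs).2.1, fun k hk => hK k (by omega)⟩
    rcases hs.lt_or_eq with h | rfl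
    · exact (hmin s h).1
    · have hβ3 : β ≤ 1 := by nlinarith [(Nat.cast_nonneg L : (0 : ℝ) ≤ L)]
      exact hst0.level_succ_eq hW (hmin t (Nat.lt_succ_self t)).2.1 (by linarith)
  have hnear : ∀ s ≤ t + 1, ∀ i,
      ‖S.auxEst x₀ ε i (τ + s) - avg (fun j => S.auxEst x₀ ε j (τ + s))‖
        ≤ 2 * L * ((L + 1) * β) / c ^ 2 := fun s hs i =>
    (hst.mono hs).norm_auxEst_sub_avg_le hN hW hL0 hc hL hβ.le i
  have hlast := hst.norm_avg_succ_sub_le hN hnet hL' hβ.le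
  have havgt : ‖avg (fun i => S.auxEst x₀ ε i (τ + (t + 1)))‖ < c₀ + (L + 1) * β := by
    have h1 := (hmin t (Nat.lt_succ_self t)).2.2.1
    have h2 := norm_sub_norm_le (avg (fun i => S.auxEst x₀ ε i (τ + t + 1)))
      (avg (fun i => S.auxEst x₀ ε i (τ + t)))
    rw [← add_assoc]
    linarith
  have hbound : ∀ s ≤ t + 1, ∀ i, ‖S.auxEst x₀ ε i (τ + s)‖ ≤ c₀ + 1 := by
    intro s hs i
    rcases hs.lt_or_eq with h | rfl
    · exact (hmin s h).2.1 i
    · have h1 := hnear _ le_rfl i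
      have h2 := norm_sub_norm_le (S.auxEst x₀ ε i (τ + (t + 1)))
        (avg (fun j => S.auxEst x₀ ε j (τ + (t + 1))))
      linarith
  have hvb : b ≤ v (avg fun i => S.auxEst x₀ ε i (τ + (t + 1))) := by
    by_contra hlt
    refine hspec ⟨hst.level_eq _ le_rfl, hbound _ le_rfl, ?_, not_le.1 hlt⟩
    by_contra hge
    exact hlt (hvρ _ (not_lt.1 hge) (by linarith))
  obtain ⟨p, hp1, hp2, hp3, hp4⟩ := exists_last_le
    (u := fun s => v (avg fun i => S.auxEst x₀ ε i (τ + s))) (Nat.zero_le (t + 1))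
    (by simpa only [add_zero, havg0] using hva.le) (hab.trans_le hvb)
  -- The crossing starts after all agents have reached the level, since before that the average
  -- is too close to the reset point.
  have hpL : L ≤ p := by
    by_contra hlt
    have h1 := hp4 (p + 1) (Nat.lt_succ_self p) hp2
    have h2 : ‖avg (fun i => S.auxEst x₀ ε i (τ + (p + 1))) - S.xstar‖ ≤ (p + 1 : ℕ) * β :=
      norm_avg_sub_le hN fun i => (hst.mono hp2).norm_auxEst_sub_xstar_le hW hβ.le i
    have h3 : ((p + 1 : ℕ) : ℝ) ≤ L + 1 := by exact_mod_cast (by omega : p + 1 ≤ L + 1)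
    have h4 := mul_le_mul_of_nonneg_right h3 hβ.le
    exact absurd (hvr _ (by linarith)) (not_lt.2 h1.le)
  have hact : ∀ s, L ≤ s → s ≤ t + 1 → ∀ i,
      S.truncNum x₀ ε i (τ + s) = S.level x₀ ε (τ + s) := fun s h1 h2 i =>
    (hst.mono h2).truncNum_eq_level hW hL' h1 i
  have haux : ∀ s, L ≤ s → s ≤ t + 1 → ∀ i,
      S.auxEst x₀ ε i (τ + s) = S.est x₀ ε i (τ + s) := fun s h1 h2 i =>
    S.auxEst_of_truncNum_eq x₀ ε (hact s h1 h2 i)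
  have havg : ∀ s, L ≤ s → s ≤ t + 1 → (avg fun i => S.auxEst x₀ ε i (τ + s))
      = avg fun i => S.est x₀ ε i (τ + s) := fun s h1 h2 => by
    simp only [haux s h1 h2]
  refine ⟨τ + p, by omega, τ + (t + 1), by omega, ⟨?_, ?_, ?_⟩, ?_, ?_, ?_⟩
  · intro q h1 h2 i
    obtain ⟨s, rfl⟩ := Nat.exists_eq_add_of_le (show τ ≤ q by omega)
    rw [← haux s (by omega) (by omega)]
    exact hbound s (by omega) i
  · intro q h1 h2 i
    obtain ⟨s, rfl⟩ := Nat.exists_eq_add_of_le (show τ ≤ q by omega)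
    rw [← haux s (by omega) (by omega), ← havg s (by omega) (by omega)]
    exact (hnear s (by omega) i).trans hβρ
  · intro q h1 h2 i
    obtain ⟨s, rfl⟩ := Nat.exists_eq_add_of_le (show τ ≤ q by omega)
    have h3 := (S.auxEst_succ_of_truncNum_eq x₀ ε (hact s (by omega) (by omega) i)
      (hst.level_succ (s := s) (by omega))).2
    rw [add_assoc, haux (s + 1) (by omega) (by omega)] at h3
    simp only [haux s (by omega) (by omega)] at h3
    exact h3
  · rw [← havg p hpL (by omega)]
    exact hp3
  · intro q h1 h2
    obtain ⟨s, rfl⟩ := Nat.exists_eq_add_of_le (show τ ≤ q by omega)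
    rw [← havg s (by omega) (by omega)]
    exact hp4 s (by omega) (by omega)
  · rw [← havg (t + 1) (by omega) le_rfl]
    exact hvb

/-- The truncation numbers of all agents stay bounded. -/
theorem exists_level_le (hN : 0 < N) (hJ : S.rootSet.Nonempty) (hstep : S.StepSizeCondition)
    (hlyap : S.LyapunovCondition) (hcont : ∀ i, Continuous (S.f i)) (hnet : S.NetworkCondition)
    (hnoise : ∀ i, S.NoiseCondition (ε i) (S.est x₀ ε i)) :
    ∃ m, ∀ k, S.level x₀ ε k ≤ m := by
  by_contra! hunb
  obtain ⟨v, hv, hdesc, hdense, c₀, hc₀, hx, hvx⟩ := hlyap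
  have hd : Dense (closure (v '' S.rootSet))ᶜ := interior_eq_empty_iff_dense_compl.1 hdense
  obtain ⟨a, ha, ha1, ha2⟩ := hd.exists_between hvx
  obtain ⟨b, hab, hb⟩ := exists_between ha2
  exact false_of_upcrossings hN hstep hcont hnet hnoise hv
    (fun z hz => inner_meanFun_gradient_neg hJ hcont hdesc hz) hab
    (fun h => ha (subset_closure h)) fun ρ hρ =>
    exists_upcrossing_of_unbounded hN hstep hcont hnet (fun i => (hnoise i).1) hunb hv.continuous
      hc₀ hx ha1 hab hb hρ

end DSAAWET

/-! ### Asymptotics after the last truncation -/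

namespace DSAAWET

variable {N l : ℕ} {S : DSAAWET N l}

theorem exists_forall_truncNum_succ_eq {x₀ : Fin N → Vec l} {ε : Fin N → ℕ → Vec l}
    (hnet : S.NetworkCondition) {m : ℕ} (hm : ∀ k, S.level x₀ ε k ≤ m) :
    ∃ k₀, 0 < k₀ ∧ ∀ k ≥ k₀, ∀ i, S.truncNum x₀ ε i (k + 1) = S.truncNum x₀ ε i k ∧
      S.est x₀ ε i (k + 1) = ∑ j, S.W k i j • S.est x₀ ε j k
        + S.γ k • (S.f i (S.est x₀ ε i k) + ε i (k + 1)) := by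
  have hW := hnet.mem_rowStochastic
  obtain ⟨L, hL0, c, hc, hL⟩ := hnet.exists_le_transition
  obtain ⟨k₁, hk₁⟩ : ∃ k₁, ∀ k ≥ k₁, S.level x₀ ε k = S.level x₀ ε k₁ := by
    obtain ⟨m', k₁, h⟩ := converges_of_monotone_of_bounded (S.level_mono x₀ ε) hm
    exact ⟨k₁, fun k hk => (h k hk).trans (h k₁ le_rfl).symm⟩
  have hact : ∀ k ≥ k₁ + L, ∀ i, S.truncNum x₀ ε i k = S.level x₀ ε k := fun k hk i => by
    refine le_antisymm (S.truncNum_le_level x₀ ε i _) ?_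
    rw [hk₁ k (by omega)]
    exact (S.level_le_truncNum_add x₀ ε hW (fun q i j => hc.trans_le (hL q i j)) i k₁).trans
      (S.truncNum_mono x₀ ε i hk)
  refine ⟨k₁ + L, by omega, fun k hk i => ⟨?_, ?_⟩⟩
  · rw [hact k hk, hact (k + 1) (by omega), hk₁ k (by omega), hk₁ (k + 1) (by omega)]
  · have h := (S.auxEst_succ_of_truncNum_eq x₀ ε (hact k hk i)
      (by rw [hk₁ k (by omega), hk₁ (k + 1) (by omega)])).2
    rw [S.auxEst_of_truncNum_eq x₀ ε (hact (k + 1) (by omega) i)] at h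
    simpa only [fun j => S.auxEst_of_truncNum_eq x₀ ε (hact k hk j)] using h

theorem norm_est_le {x₀ : Fin N → Vec l} {ε : Fin N → ℕ → Vec l} {m : ℕ}
    (hm : ∀ k, S.level x₀ ε k ≤ m) (i : Fin N) {k : ℕ} (hk : 0 < k) :
    ‖S.est x₀ ε i k‖ ≤ S.M m := by
  obtain ⟨k, rfl⟩ : ∃ j, k = j + 1 := ⟨k - 1, by omega⟩
  exact (S.norm_est_succ_le x₀ ε i k).trans (S.M_mono (hm k))

section Asymptotics

variable {x ε : Fin N → ℕ → Vec l} {R : ℝ} {k₀ : ℕ} (hN : 0 < N) (hstep : S.StepSizeCondition)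
  (hcont : ∀ i, Continuous (S.f i)) (hnet : S.NetworkCondition)
  (hbound : ∀ k ≥ k₀, ∀ i, ‖x i k‖ ≤ R)
  (hsucc : ∀ k ≥ k₀, ∀ i,
    x i (k + 1) = ∑ j, S.W k i j • x j k + S.γ k • (S.f i (x i k) + ε i (k + 1)))

include hN hstep hcont hnet hbound hsucc

/-- Consensus: bounded estimates that follow the averaging scheme approach their average. -/
theorem eventually_norm_sub_avg_le
    (hε : ∀ i, Tendsto (fun k => S.γ k • ε i (k + 1)) atTop (𝓝 0)) {ρ : ℝ} (hρ : 0 < ρ) :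
    ∀ᶠ k in atTop, ∀ i, ‖x i k - avg (fun j => x j k)‖ ≤ ρ := by
  have hW := hnet.mem_rowStochastic
  obtain ⟨L, hL0, c, hc, hL⟩ := hnet.exists_le_transition
  have hc1 : c ≤ 1 := (hL 0 ⟨0, hN⟩ ⟨0, hN⟩).trans
    (Matrix.le_one_of_mem_rowStochastic (transition_mem_rowStochastic hW 0 L))
  have hL0' : (0 : ℝ) < L := by exact_mod_cast hL0
  obtain ⟨β, hβ, hβρ⟩ : ∃ β > 0, 2 * L * β / c ^ 2 = ρ / 2 :=
    ⟨ρ * c ^ 2 / (4 * L), by positivity, by field_simp; norm_num⟩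
  obtain ⟨K, hK⟩ := eventually_atTop.1 (eventually_norm_step_le hstep hcont hε R hβ)
  have hpow : Tendsto (fun t : ℕ => (1 - c ^ 2) ^ (t / L) * (2 * R)) atTop (𝓝 (0 * (2 * R))) :=
    ((tendsto_pow_atTop_nhds_zero_of_lt_one (by nlinarith) (by nlinarith)).comp
      (Nat.tendsto_div_const_atTop hL0.ne')).mul_const _
  rw [zero_mul] at hpow
  obtain ⟨t₀, ht₀⟩ := eventually_atTop.1 (hpow.eventually_lt_const (half_pos hρ))
  filter_upwards [eventually_ge_atTop (max K k₀ + t₀)] with k hk i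
  obtain ⟨t, rfl⟩ := Nat.exists_eq_add_of_le (show max K k₀ ≤ k by omega)
  rw [norm_sub_rev]
  refine norm_avg_sub_le hN fun j => ?_
  have h1 := norm_sub_le_of_perturbed_averaging hW hL0 hc hL (X := fun q i => x i q) (β := β)
    (D := 2 * R) (τ := max K k₀) hβ.le (fun i j => ?_) t ?_ j i
  · linarith [ht₀ t (by omega)]
  · have h2 := hbound (max K k₀) (le_max_right _ _) i
    have h3 := hbound (max K k₀) (le_max_right _ _) j
    linarith [norm_sub_le (x i (max K k₀)) (x j (max K k₀))]
  · intro q hq _ i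
    rw [max_le_iff] at hq
    rw [hsucc q hq.2 i, add_sub_cancel_left]
    exact hK q hq.1 i _ (hbound q hq.2 i)

theorem exists_forall_regularOn
    (hε : ∀ i, Tendsto (fun k => S.γ k • ε i (k + 1)) atTop (𝓝 0)) {ρ : ℝ} (hρ : 0 < ρ) :
    ∃ K, ∀ n ≥ K, ∀ ℓ, S.RegularOn x ε R ρ n ℓ := by
  obtain ⟨K, hK⟩ := eventually_atTop.1
    (eventually_norm_sub_avg_le hN hstep hcont hnet hbound hsucc hε hρ)
  refine ⟨max K k₀, fun n hn ℓ => ?_⟩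
  rw [ge_iff_le, max_le_iff] at hn
  exact ⟨fun q hq _ => hbound q (by omega), fun q hq _ => hK q (by omega),
    fun q hq _ => hsucc q (by omega)⟩

theorem tendsto_dist_avg_succ
    (hε : ∀ i, Tendsto (fun k => S.γ k • ε i (k + 1)) atTop (𝓝 0)) :
    Tendsto (fun k => dist (avg fun i => x i (k + 1)) (avg fun i => x i k)) atTop (𝓝 0) := by
  refine Metric.tendsto_nhds.2 fun β hβ => ?_
  filter_upwards [eventually_norm_step_le hstep hcont hε R (half_pos hβ),
    eventually_ge_atTop k₀] with k hk hkk
  rw [Real.dist_0_eq_abs, abs_of_nonneg dist_nonneg, dist_eq_norm,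
    ← avg_sum_smul (hnet.1 k) (fun i => x i k), ← avg_sub]
  refine (norm_avg_le hN fun i => ?_).trans_lt (half_lt_self hβ)
  rw [hsucc k hkk i, add_sub_cancel_left]
  exact hk i _ (hbound k hkk i)

variable (hnoise : ∀ i, S.NoiseCondition (ε i) (x i)) {v : Vec l → ℝ} (hv : ContDiff ℝ 1 v)
  (hdesc : ∀ z ∉ S.rootSet, inner ℝ (S.meanFun z) (gradient v z) < 0)
  (hdense : IsNowhereDense (v '' S.rootSet))

include hnoise hv hdesc hdense

/-- The Lyapunov function converges along the averages, since it cannot make infinitely many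
upcrossings between levels that are not attained at roots, and these levels are dense. -/
theorem exists_tendsto_apply_avg :
    ∃ y, Tendsto (fun k => v (avg fun i => x i k)) atTop (𝓝 y) := by
  have hε := fun i => (hnoise i).1
  have hball : ∀ᶠ k in atTop, ‖avg fun i => x i k‖ ≤ R := by
    filter_upwards [eventually_ge_atTop k₀] with k hk using norm_avg_le hN (hbound k hk)
  obtain ⟨C, hC⟩ := (isCompact_closedBall (0 : Vec l) R).exists_bound_of_continuousOn
    hv.continuous.continuousOn
  have hvC : ∀ᶠ k in atTop, |v (avg fun i => x i k)| ≤ C := by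
    filter_upwards [hball] with k hk using hC _ (by simpa using hk)
  refine tendsto_of_no_upcrossings (interior_eq_empty_iff_dense_compl.1 hdense) ?_
    (isBoundedUnder_of_eventually_le (hvC.mono fun k hk => (abs_le.1 hk).2))
    (isBoundedUnder_of_eventually_ge (hvC.mono fun k hk => (abs_le.1 hk).1))
  rintro a ha b - hab ⟨hfa, hfb⟩
  refine false_of_upcrossings hN hstep hcont hnet hnoise hv hdesc hab
    (fun h => ha (subset_closure h)) (R := R) fun ρ hρ => frequently_atTop.2 fun K₀ => ?_
  obtain ⟨K, hK⟩ := exists_forall_regularOn hN hstep hcont hnet hbound hsucc hε hρ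
  obtain ⟨n, hn, hna⟩ := frequently_atTop.1 hfa (max K K₀)
  rw [max_le_iff] at hn
  obtain ⟨ℓ, hℓ, hℓb⟩ := frequently_atTop.1 hfb n
  obtain ⟨p, h1, h2, h3, h4⟩ := exists_last_le (u := fun k => v (avg fun i => x i k)) hℓ hna.le
    (hab.trans hℓb)
  exact ⟨p, by omega, ℓ, h2, hK p (by omega) ℓ, h3, h4, hℓb.le⟩

/-- Near a cluster point that is not a root the Lyapunov function would drop by a fixed amount
infinitely often, against its convergence. -/
theorem mem_rootSet_of_mapClusterPt {z : Vec l}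
    (hz : MapClusterPt z atTop fun k => avg fun i => x i k) : z ∈ S.rootSet := by
  by_contra hzJ
  obtain ⟨y, hy⟩ := exists_tendsto_apply_avg hN hstep hcont hnet hbound hsucc hnoise hv hdesc hdense
  obtain ⟨n, hn, hn'⟩ := extraction_forall_of_frequently
    (P := fun k n => dist (avg fun i => x i n) z < 1 / ((k : ℝ) + 1) ∧
      ∀ ℓ, S.RegularOn x ε R (1 / ((k : ℝ) + 1)) n ℓ) fun k => by
    have hpos : 0 < 1 / ((k : ℝ) + 1) := by positivity
    obtain ⟨K, hK⟩ := exists_forall_regularOn hN hstep hcont hnet hbound hsucc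
      (fun i => (hnoise i).1) hpos
    exact (mapClusterPt_iff_frequently.1 hz _ (Metric.ball_mem_nhds z hpos)).and_eventually
      (eventually_atTop.2 ⟨K, hK⟩)
  have hρ : Tendsto (fun k : ℕ => 1 / ((k : ℝ) + 1)) atTop (𝓝 0) :=
    tendsto_one_div_add_atTop_nhds_zero_nat
  have hnz : Tendsto (fun k => avg fun i => x i (n k)) atTop (𝓝 z) :=
    tendsto_iff_dist_tendsto_zero.2
      (squeeze_zero (fun _ => dist_nonneg) (fun k => (hn' k).1.le) hρ)
  choose ℓ hnℓ hℓ using fun k => hstep.exists_le_sum_Icc (n k) 2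
  obtain ⟨κ, hκ, hdec⟩ := exists_eventually_apply_avg_le hN hstep hcont hnet hnoise hn
    (fun k => Nat.lt_succ_of_le (hnℓ k)) (fun k => (hn' k).2 (ℓ k + 1)) hρ hnz hv (hdesc z hzJ)
  obtain ⟨T, ⟨hT, hT1⟩, hT0⟩ := ((hdec.and (Ioo_mem_nhdsGT one_pos)).and self_mem_nhdsWithin).exists
  replace hT0 : 0 < T := hT0
  obtain ⟨K₁, hK₁⟩ := eventually_atTop.1 (hstep.2.1.eventually_lt_const (half_pos hT0))
  obtain ⟨K₂, hK₂⟩ := eventually_atTop.1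
    (Metric.tendsto_nhds.1 hy (κ * T / 2) (by positivity))
  obtain ⟨k, hk, hkn⟩ := (hT.and (hn.tendsto_atTop.eventually_ge_atTop (max K₁ K₂))).exists
  rw [max_le_iff] at hkn
  obtain ⟨p, hp, hp1, hp2⟩ := hstep.exists_sum_Icc_mem (n := n k) (T := T)
    fun m hm => (hK₁ m (hkn.1.trans hm)).le
  have hpℓ : p < ℓ k + 1 := by
    by_contra hlt
    have : ∑ m ∈ Finset.Icc (n k) (ℓ k), S.γ m ≤ ∑ m ∈ Finset.Icc (n k) p, S.γ m :=
      Finset.sum_le_sum_of_subset_of_nonneg (Finset.Icc_subset_Icc_right (by omega))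
        fun m _ _ => (hstep.1 m).le
    linarith [hℓ k, hT1.2]
  have h1 := hk p hp hpℓ hp2 hp1
  have h2 := hK₂ (n k) hkn.2
  have h3 := hK₂ (p + 1) (by omega)
  rw [Real.dist_eq, abs_lt] at h2 h3
  linarith

end Asymptotics

end DSAAWET

/-! ### Stacked vectors -/

theorem kronecker_one_mulVec_stack {N l : ℕ} (A : Matrix (Fin N) (Fin N) ℝ) (y : Fin N → Vec l) :
    (A ⊗ₖ (1 : Matrix (Fin l) (Fin l) ℝ)).mulVec (stack y) = stack fun i => ∑ j, A i j • y j := by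
  ext ⟨i, a⟩
  simp [Matrix.mulVec, dotProduct, stack, Fintype.sum_prod_type, Matrix.one_apply]

theorem disagreementMatrix_mulVec_stack {N l : ℕ} (y : Fin N → Vec l) :
    (disagreementMatrix N l).mulVec (stack y) = stack fun i => y i - DSAAWET.avg y := by
  rw [disagreementMatrix, kronecker_one_mulVec_stack]
  congr 1
  ext1 i
  simp [Matrix.one_apply, sub_smul, Finset.sum_sub_distrib, DSAAWET.avg, Finset.smul_sum]

theorem theorem1 {N l : ℕ} (hN : 0 < N) (S : DSAAWET N l) (hJ : S.rootSet.Nonempty)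
    (hstep : S.StepSizeCondition) (hlyap : S.LyapunovCondition)
    (hcont : ∀ i, Continuous (S.f i)) (hnet : S.NetworkCondition)
    {Ω : Type*} (x₀ : Ω → Fin N → Vec l) (ε : Ω → Fin N → ℕ → Vec l)
    (ω : Ω) (x : Fin N → ℕ → Vec l) (hx : x = S.est (x₀ ω) (ε ω))
    (hnoise : ∀ i, S.NoiseCondition (ε ω i) (x i)) :
    -- boundedness, and a finite time after which there are no truncations
    (∀ i, Bornology.IsBounded (Set.range (x i))) ∧
    (∃ k₀ : ℕ, 0 < k₀ ∧ ∀ k ≥ k₀,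
      (∀ i, S.truncNum (x₀ ω) (ε ω) i (k + 1) = S.truncNum (x₀ ω) (ε ω) i k) ∧
      (∀ i, x i (k + 1) = (∑ j ∈ S.nbr k i, S.W k i j • x j k)
        + S.γ k • (S.f i (x i k) + ε ω i (k + 1))) ∧
      stack (fun i => x i (k + 1)) =
        (S.W k ⊗ₖ (1 : Matrix (Fin l) (Fin l) ℝ)).mulVec (stack fun i => x i k)
          + S.γ k • (stack (fun i => S.f i (x i k)) + stack (fun i => ε ω i (k + 1)))) ∧
    -- consensus, and convergence of the average to the root set
    Tendsto (fun k => (disagreementMatrix N l).mulVec (stack fun i => x i k)) atTop (𝓝 0) ∧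
    Tendsto (fun k => Metric.infDist ((1 / (N : ℝ)) • ∑ i, x i k) S.rootSet) atTop (𝓝 0) ∧
    -- convergence of the average to a connected set of roots
    ∃ Jstar : Set (Vec l), Jstar ⊆ S.rootSet ∧ IsConnected Jstar ∧
      Tendsto (fun k => Metric.infDist ((1 / (N : ℝ)) • ∑ i, x i k) Jstar) atTop (𝓝 0) := by
  subst hx
  obtain ⟨m, hm⟩ := DSAAWET.exists_level_le hN hJ hstep hlyap hcont hnet hnoise
  obtain ⟨k₀, hk₀, hsucc⟩ := DSAAWET.exists_forall_truncNum_succ_eq hnet hm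
  obtain ⟨v, hv, hdesc, hdense, -⟩ := hlyap
  have hε := fun i => (hnoise i).1
  have hbound : ∀ k ≥ k₀, ∀ i, ‖S.est (x₀ ω) (ε ω) i k‖ ≤ S.M m := fun k hk i =>
    DSAAWET.norm_est_le hm i (hk₀.trans_le hk)
  have hsucc' := fun k hk i => (hsucc k hk i).2
  have hball : ∀ᶠ k in atTop, DSAAWET.avg (fun i => S.est (x₀ ω) (ε ω) i k)
      ∈ Metric.closedBall (0 : Vec l) (S.M m) := by
    filter_upwards [eventually_ge_atTop k₀] with k hk
    rw [mem_closedBall_zero_iff]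
    exact DSAAWET.norm_avg_le hN (hbound k hk)
  have hsub : {z | MapClusterPt z atTop fun k => DSAAWET.avg fun i => S.est (x₀ ω) (ε ω) i k}
      ⊆ S.rootSet := fun z hz =>
    DSAAWET.mem_rootSet_of_mapClusterPt hN hstep hcont hnet hbound hsucc' hnoise hv
      (fun z hz => DSAAWET.inner_meanFun_gradient_neg hJ hcont hdesc hz) hdense hz
  have hconn := isConnected_setOf_mapClusterPt Metric.isBounded_closedBall hball
    (DSAAWET.tendsto_dist_avg_succ hN hstep hcont hnet hbound hsucc' hε)
  have hlim := tendsto_infDist_setOf_mapClusterPt Metric.isBounded_closedBall hball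
  refine ⟨fun i => ?_, ⟨k₀, hk₀, fun k hk => ⟨fun i => (hsucc k hk i).1, fun i => ?_, ?_⟩⟩, ?_,
    ?_, _, hsub, hconn, hlim⟩
  · refine isBounded_iff_forall_norm_le.2 ⟨max ‖S.est (x₀ ω) (ε ω) i 0‖ (S.M m), ?_⟩
    rintro _ ⟨k, rfl⟩
    rcases Nat.eq_zero_or_pos k with rfl | hk
    · exact le_max_left _ _
    · exact (DSAAWET.norm_est_le hm i hk).trans (le_max_right _ _)
  · rw [S.sum_nbr_smul]
    exact hsucc' k hk i
  · rw [kronecker_one_mulVec_stack]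
    simp only [hsucc' k hk]
    rfl
  · simp only [disagreementMatrix_mulVec_stack]
    have h : ∀ i, Tendsto (fun k => S.est (x₀ ω) (ε ω) i k
        - DSAAWET.avg fun j => S.est (x₀ ω) (ε ω) j k) atTop (𝓝 0) := fun i =>
      Metric.tendsto_nhds.2 fun ρ hρ => by
        filter_upwards [DSAAWET.eventually_norm_sub_avg_le hN hstep hcont hnet hbound hsucc' hε
          (half_pos hρ)] with k hk
        rw [dist_zero_right]
        exact (hk i).trans_lt (half_lt_self hρ)
    refine tendsto_pi_nhds.2 fun p => ?_
    exact ((EuclideanSpace.proj p.2 : Vec l →L[ℝ] ℝ).continuous.tendsto 0).comp (h p.1)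
  · exact squeeze_zero (fun _ => Metric.infDist_nonneg)
      (fun k => Metric.infDist_le_infDist_of_subset hsub hconn.nonempty) hlim
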